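/- Let $\mathsf{TOF}$ be the strict symmetric monoidal category with objects the natural numbers ($n\otimes m=n+m$; maps $n\to m$ are circuits with $n$ input and $m$ output wires, wires being numbered $0,1,2,\dots$ from top to bottom) generated by the ancillae $|1\rangle:0\to1$ and $\langle1|:1\to0$ and the Toffoli gate $\mathsf{tof}:3\to3$ (controls $0,1$, target $2$), subject to the identities below. Juxtaposition $fg$ means first $f$, then $g$; $\otimes$ puts its first factor on top. Put $\mathsf{cnot}:=(|1\rangle\otimes1_2)\,\mathsf{tof}\,(\langle1|\otimes1_2)$ (control $0$, target $1$), $\mathsf{not}:=(|1\rangle\otimes1_1)\,\mathsf{cnot}\,(\langle1|\otimes1_1)$, $|0\rangle:=|1\rangle\,\mathsf{not}$ and $\langle0|:=\mathsf{not}\,\langle1|$. Gates may be placed on arbitrary distinct wires of a larger circuit by conjugating with wire crossings: $T^{ab}_c$ and $C^a_c$ denote $\mathsf{tof}$ and $\mathsf{cnot}$ placed with controls $a,b$ (resp. $a$), in this order, and target $c$. Let $\rhd_z$ and $\lhd_z$ denote $|0\rangle$ creating, and $\langle0|$ terminating, the wire in position $z$, and let $\blacktriangleright_z$ be the same for $|1\rangle$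 creating a wire. The identities are: 1. $(|1\rangle\otimes1_2)\,\mathsf{tof}=|1\rangle\otimes\mathsf{cnot}$ and $\mathsf{tof}\,(\langle1|\otimes1_2)=\langle1|\otimes\mathsf{cnot}$; 2. $(|0\rangle\otimes1_2)\,\mathsf{tof}=|0\rangle\otimes1_2$ and $\mathsf{tof}\,(\langle0|\otimes1_2)=\langle0|\otimes1_2$; 3. $T^{01}_2T^{43}_2=T^{43}_2T^{01}_2$ and $T^{21}_0T^{23}_4=T^{23}_4T^{21}_0$ on five wires; $T^{21}_0T^{12}_3=T^{12}_3T^{21}_0$ and $T^{02}_3T^{12}_3=T^{12}_3T^{02}_3$ on four wires; 4. $\blacktriangleright_2C^0_2\lhd_2\blacktriangleright_2C^1_2\lhd_2=\blacktriangleright_2T^{01}_2\lhd_2$ as maps $2\to2$; 5. $(|1\rangle\langle0|)\otimes1_1=(|1\rangle\langle0|)\otimes(\langle1|\,|1\rangle)$ (diagrammatic order, so that $|1\rangle\langle0|:0\to0$ and $\langle 1|\,|1\rangle:1\to1$), and $|1\rangle\langle1|=1_0$; 6. $\mathsf{tof}\,\mathsf{tof}=1_3$; 7. on four wires, $T^{12}_3T^{01}_2T^{12}_3=T^{01}_3T^{01}_2$,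 $\;C^0_1T^{12}_3C^0_1=T^{02}_3T^{12}_3$, $\;T^{01}_2T^{12}_3T^{01}_2=T^{01}_3T^{12}_3$, $\;T^{01}_2C^2_3T^{01}_2=T^{01}_3C^2_3$; 8. on two wires, $C^0_1C^1_0C^0_1$ is the crossing of the two wires; 9. $\mathsf{tof}$ is unchanged by conjugation with the crossing of its two control wires, and $\rhd_2T^{01}_2T^{23}_4T^{01}_2\lhd_2:4\to4$ is unchanged by conjugation with the crossing of the wires $1$ and $2$. Define $\mathsf{cnot}_n:n+1\to n+1$ (controls $0,\dots,n-1$, target $n$) by $\mathsf{cnot}_0=\mathsf{not}$, $\mathsf{cnot}_1=\mathsf{cnot}$, $\mathsf{cnot}_2=\mathsf{tof}$ and, for $n\ge2$, $\mathsf{cnot}_{n+1}=\rhd_2\,T^{01}_2\,(1_2\otimes\mathsf{cnot}_n)\,T^{01}_2\,\lhd_2$. For a set $X$ of wires of a circuit and a wire $x\notin X$, let $\oplus_x^X$ be $\mathsf{cnot}_{|X|}$ placed with the wires in $X$ (in increasing order) as its controls and $x$ as its target; the other wires pass through. **Lemma (Iwama's identities).** The following hold in $\mathsf{TOF}$, for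 any number of wires, any wires $x,y,z$ and any sets $X,Y$ of wires for which all gates that occur are defined (no target wire lies in its own control set; $\sqcup$ denotes a union required to be disjoint; in (ii) and (vi) the gates act on the wires of the circuit that include the newly created wire): - (i) $\oplus_x^X\oplus_x^X=1$; - (ii) if $x\in X$ then $\rhd_x\oplus_y^X=\rhd_x$; - (iii) $\oplus_x^X\oplus_x^Y=\oplus_x^Y\oplus_x^X$; - (iv) if $x\notin Y$ and $y\notin X$ then $\oplus_x^X\oplus_y^Y=\oplus_y^Y\oplus_x^X$; - (v) $\oplus_x^X\oplus_y^{\{x\}\sqcup Y}=\oplus_y^{X\cup Y}\oplus_y^{\{x\}\sqcup Y}\oplus_x^X$; - (vi) $\rhd_z\oplus_z^{\{x\}}\oplus_y^{\{x\}\sqcup X}=\rhd_z\oplus_z^{\{x\}}\oplus_y^{\{z\}\sqcup X}$. -/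

import Mathlib

open CategoryTheory

/-- Circuit terms `n → m` over the generators `|1⟩`, `⟨1|` and the Toffoli gate. Wires are numbered
from top (`0`) to bottom. `perm σ` is a pure wire crossing: it takes the wire in position `i` to
position `σ i`. Composition is diagrammatic, and `tensor f g` stacks `f` on top of `g`. -/
inductive Circ : ℕ → ℕ → Type
  | ket1 : Circ 0 1
  | bra1 : Circ 1 0
  | tof : Circ 3 3
  | perm {n m : ℕ} (σ : Fin n ≃ Fin m) : Circ n m
  | comp {n m k : ℕ} (f : Circ n m) (g : Circ m k) : Circ n k
  | tensor {n m n' m' : ℕ} (f : Circ n m) (g : Circ n' m') : Circ (n + n') (m + m')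

namespace Circ

/-- Juxtaposition of two bijections: the first on the upper wires, the second on the lower ones. -/
def sumPerm {n m n' m' : ℕ} (σ : Fin n ≃ Fin m) (τ : Fin n' ≃ Fin m') :
    Fin (n + n') ≃ Fin (m + m') :=
  finSumFinEquiv.symm.trans ((Equiv.sumCongr σ τ).trans finSumFinEquiv)

/-- The identity circuit. -/
def id (n : ℕ) : Circ n n := perm (Equiv.refl _)

/-- An enumeration of all `n` wires that starts with the wires `w 0, …, w (k - 1)` and continues with
the remaining ones in increasing order. -/
noncomputable def wireEquiv {k n : ℕ} (w : Fin k ↪ Fin n) : Fin (k + (n - k)) ≃ Fin n :=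
  finSumFinEquiv.symm.trans <|
    (Equiv.sumCongr
      ((Equiv.ofBijective (fun i => (⟨w i, Finset.mem_map_of_mem w (Finset.mem_univ i)⟩ :
          {a // a ∈ Finset.univ.map w}))
        ⟨fun i j h => w.injective (congrArg Subtype.val h), fun ⟨a, ha⟩ => by
          obtain ⟨i, -, rfl⟩ := Finset.mem_map.1 ha
          exact ⟨i, rfl⟩⟩))
      ((((Finset.univ.map w)ᶜ).orderIsoOfFin
          (by rw [Finset.card_compl, Finset.card_map, Finset.card_fin, Fintype.card_fin])).toEquiv.trans
        (Equiv.subtypeEquivRight (fun a => Finset.mem_compl)))).trans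
    (Equiv.sumCompl (fun a => a ∈ Finset.univ.map w))

/-- The gate `g` placed (with gaps and crossings) on the wires of an `n`-wire circuit: the `i`-th wire
of `g` is the wire `w i` of the circuit, and all other wires pass through unchanged. -/
noncomputable def on {k n : ℕ} (g : Circ k k) (w : Fin k ↪ Fin n) : Circ n n :=
  comp (comp (perm (wireEquiv w).symm) (tensor g (id (n - k)))) (perm (wireEquiv w))

/-- The bijection taking the last position to `z`, and the others to the remaining positions in
increasing order. -/
def lastTo {n : ℕ} (z : Fin (n + 1)) : Fin (n + 1) ≃ Fin (n + 1) :=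
  (finSuccEquiv' (Fin.last n)).trans (finSuccEquiv' z).symm

/-- Creation of a new wire in position `z` by the input ancilla `g`. -/
def insertAt {n : ℕ} (g : Circ 0 1) (z : Fin (n + 1)) : Circ n (n + 1) :=
  comp (tensor (id n) g) (perm (lastTo z))

/-- Termination of the wire in position `z` by the output ancilla `g`. -/
def removeAt {n : ℕ} (g : Circ 1 0) (z : Fin (n + 1)) : Circ (n + 1) n :=
  comp (perm (lastTo z).symm) (tensor (id n) g)

/-- The controlled not gate; the control is wire `0`, the target is wire `1`. -/
def cnot : Circ 2 2 := comp (comp (tensor ket1 (id 2)) tof) (tensor bra1 (id 2))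

/-- The not gate. -/
def not : Circ 1 1 := comp (comp (tensor ket1 (id 1)) cnot) (tensor bra1 (id 1))

/-- The input ancilla `|0⟩`. -/
def ket0 : Circ 0 1 := comp ket1 not

/-- The output ancilla `⟨0|`. -/
def bra0 : Circ 1 0 := comp not bra1

/-- The Toffoli gate on an `n`-wire circuit with controls `a`, `b` and target `c`. -/
noncomputable def tofOn {n : ℕ} (a b c : Fin n) (h : Function.Injective ![a, b, c] := by decide) : Circ n n :=
  tof.on ⟨![a, b, c], h⟩

/-- The controlled not gate on an `n`-wire circuit with control `a` and target `c`. -/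
noncomputable def cnotOn {n : ℕ} (a c : Fin n) (h : Function.Injective ![a, c] := by decide) : Circ n n :=
  cnot.on ⟨![a, c], h⟩

/-- Equality of circuits in `TOF`: the congruence generated by the laws of symmetric (strict)
monoidal categories with objects the natural numbers and by the identities between circuits of
Toffoli gates and ancillae. -/
inductive Eqv : ∀ {n m : ℕ}, Circ n m → Circ n m → Prop
  -- equivalence relation and congruence
  | refl {n m : ℕ} (f : Circ n m) : Eqv f f
  | symm {n m : ℕ} {f g : Circ n m} : Eqv f g → Eqv g f
  | trans {n m : ℕ} {f g h : Circ n m} : Eqv f g → Eqv g h → Eqv f h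
  | comp_congr {n m k : ℕ} {f f' : Circ n m} {g g' : Circ m k} :
      Eqv f f' → Eqv g g' → Eqv (comp f g) (comp f' g')
  | tensor_congr {n m n' m' : ℕ} {f f' : Circ n m} {g g' : Circ n' m'} :
      Eqv f f' → Eqv g g' → Eqv (tensor f g) (tensor f' g')
  -- category laws
  | id_comp {n m : ℕ} (f : Circ n m) : Eqv (comp (id n) f) f
  | comp_id {n m : ℕ} (f : Circ n m) : Eqv (comp f (id m)) f
  | assoc {n m k l : ℕ} (f : Circ n m) (g : Circ m k) (h : Circ k l) :
      Eqv (comp (comp f g) h) (comp f (comp g h))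
  -- wire crossings compose and juxtapose as bijections do
  | perm_comp {n m k : ℕ} (σ : Fin n ≃ Fin m) (τ : Fin m ≃ Fin k) :
      Eqv (comp (perm σ) (perm τ)) (perm (σ.trans τ))
  | perm_tensor {n m n' m' : ℕ} (σ : Fin n ≃ Fin m) (τ : Fin n' ≃ Fin m') :
      Eqv (tensor (perm σ) (perm τ)) (perm (sumPerm σ τ))
  -- laws of the tensor product: interchange, associativity, units, symmetry
  | interchange {n m k n' m' k' : ℕ} (f : Circ n m) (g : Circ m k) (f' : Circ n' m')
      (g' : Circ m' k') :
      Eqv (tensor (comp f g) (comp f' g')) (comp (tensor f f') (tensor g g'))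
  | tensor_assoc {n m n' m' n'' m'' : ℕ} (f : Circ n m) (g : Circ n' m') (h : Circ n'' m'') :
      Eqv (comp (tensor (tensor f g) h) (perm (finCongr (Nat.add_assoc m m' m''))))
        (comp (perm (finCongr (Nat.add_assoc n n' n''))) (tensor f (tensor g h)))
  | id_tensor {n m : ℕ} (f : Circ n m) :
      Eqv (comp (tensor (id 0) f) (perm (finCongr (Nat.zero_add m))))
        (comp (perm (finCongr (Nat.zero_add n))) f)
  | tensor_id {n m : ℕ} (f : Circ n m) :
      Eqv (comp (tensor f (id 0)) (perm (finCongr (Nat.add_zero m))))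
        (comp (perm (finCongr (Nat.add_zero n))) f)
  | braid {n m n' m' : ℕ} (f : Circ n m) (g : Circ n' m') :
      Eqv (comp (tensor f g) (perm finAddFlip)) (comp (perm finAddFlip) (tensor g f))
  -- a control wire in state `1`
  | tof1 : Eqv (comp (tensor ket1 (id 2)) tof : Circ 2 3) (tensor ket1 cnot)
  | tof1' : Eqv (comp tof (tensor bra1 (id 2)) : Circ 3 2) (tensor bra1 cnot)
  -- a control wire in state `0`
  | tof2 : Eqv (comp (tensor ket0 (id 2)) tof : Circ 2 3) (tensor ket0 (id 2))
  | tof2' : Eqv (comp tof (tensor bra0 (id 2)) : Circ 3 2) (tensor bra0 (id 2))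
  -- gates sharing only their targets, or only controls, commute
  | tof3 : Eqv (comp (tofOn (0 : Fin 5) 1 2) (tofOn 4 3 2))
      (comp (tofOn 4 3 2) (tofOn 0 1 2))
  | tof4 : Eqv (comp (tofOn (2 : Fin 5) 1 0) (tofOn 2 3 4))
      (comp (tofOn 2 3 4) (tofOn 2 1 0))
  | tof5 : Eqv (comp (tofOn (2 : Fin 4) 1 0) (tofOn 1 2 3))
      (comp (tofOn 1 2 3) (tofOn 2 1 0))
  | tof6 : Eqv (comp (tofOn (0 : Fin 4) 2 3) (tofOn 1 2 3))
      (comp (tofOn 1 2 3) (tofOn 0 2 3))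
  -- conjunction of two assertions
  | tof7 : Eqv
      (comp (comp (comp (insertAt ket1 2) (cnotOn (0 : Fin 3) 2)) (removeAt bra0 2))
        (comp (comp (insertAt ket1 2) (cnotOn (1 : Fin 3) 2)) (removeAt bra0 2)))
      (comp (comp (insertAt ket1 2) (tofOn (0 : Fin 3) 1 2)) (removeAt bra0 2))
  -- the zero scalar cuts wires
  | tof8 : Eqv (tensor (comp ket1 bra0) (id 1)) (tensor (comp ket1 bra0) (comp bra1 ket1))
  | tof9 : Eqv (comp ket1 bra1) (id 0)
  | tof10 : Eqv (comp tof tof) (id 3)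
  -- pushing gates past each other
  | tof11 : Eqv (comp (comp (tofOn (1 : Fin 4) 2 3) (tofOn 0 1 2)) (tofOn 1 2 3))
      (comp (tofOn 0 1 3) (tofOn 0 1 2))
  | tof12 : Eqv (comp (comp (cnotOn (0 : Fin 4) 1) (tofOn 1 2 3)) (cnotOn 0 1))
      (comp (tofOn 0 2 3) (tofOn 1 2 3))
  | tof13 : Eqv (comp (comp (tofOn (0 : Fin 4) 1 2) (tofOn 1 2 3)) (tofOn 0 1 2))
      (comp (tofOn 0 1 3) (tofOn 1 2 3))
  | tof14 : Eqv (comp (comp (tofOn (0 : Fin 4) 1 2) (cnotOn 2 3)) (tofOn 0 1 2))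
      (comp (tofOn 0 1 3) (cnotOn 2 3))
  -- three alternating controlled nots swap two wires
  | tof15 : Eqv (comp (comp (cnotOn (0 : Fin 2) 1) (cnotOn 1 0)) (cnotOn 0 1))
      (perm (Equiv.swap (0 : Fin 2) 1))
  -- symmetry of the controls
  | tof16 : Eqv tof
      (comp (comp (perm (Equiv.swap (0 : Fin 3) 1)) tof) (perm (Equiv.swap (0 : Fin 3) 1)))
  | tof17 : Eqv
      (comp (comp (comp (comp (insertAt ket0 2) (tofOn (0 : Fin 5) 1 2)) (tofOn 2 3 4))
        (tofOn 0 1 2)) (removeAt bra0 2))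
      (comp (comp (perm (Equiv.swap (1 : Fin 4) 2))
        (comp (comp (comp (comp (insertAt ket0 2) (tofOn (0 : Fin 5) 1 2)) (tofOn 2 3 4))
          (tofOn 0 1 2)) (removeAt bra0 2)))
        (perm (Equiv.swap (1 : Fin 4) 2)))

/-- Circuits up to equality in `TOF`. -/
instance setoid (n m : ℕ) : Setoid (Circ n m) :=
  ⟨Eqv, ⟨Eqv.refl, Eqv.symm, Eqv.trans⟩⟩

/-- The not gate with `n` controls: wires `0, …, n - 1` are the controls, wire `n` is the target. -/
noncomputable def cnotN : ∀ n : ℕ, Circ (n + 1) (n + 1)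
  | 0 => not
  | 1 => cnot
  | 2 => tof
  | n + 3 =>
    comp (comp (comp (comp (insertAt ket0 (2 : Fin (n + 5)))
      (tof.on (Fin.castLEEmb (Nat.le_add_left 3 (n + 2)))))
      ((cnotN (n + 2)).on (Fin.addNatEmb 2)))
      (tof.on (Fin.castLEEmb (Nat.le_add_left 3 (n + 2)))))
      (removeAt bra0 (2 : Fin (n + 5)))

/-- The wires of a multiply controlled not gate: the controls in increasing order, then the target. -/
def ctrlWires {n : ℕ} (X : Finset (Fin n)) (x : Fin n) (hx : x ∉ X) : Fin (X.card + 1) ↪ Fin n :=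
  ⟨Fin.snoc (α := fun _ => Fin n) (X.orderEmbOfFin rfl) x, by
    rw [Fin.snoc_injective_iff]
    refine ⟨(X.orderEmbOfFin rfl).injective, ?_⟩
    rintro ⟨i, rfl⟩
    exact hx (Finset.orderEmbOfFin_mem X rfl i)⟩

end Circ

/-- The category `TOF`; its objects are the natural numbers. -/
def TOF : Type := ℕ

namespace TOF

/-- The natural number `n` as an object of `TOF`. -/
def of (n : ℕ) : TOF := n

instance : Category TOF where
  Hom n m := Quotient (Circ.setoid n m)
  id n := Quotient.mk _ (Circ.id n)
  comp := Quotient.map₂ Circ.comp fun _ _ h _ _ h' => Circ.Eqv.comp_congr h h'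
  id_comp := by
    rintro n m ⟨f⟩
    exact Quotient.sound (Circ.Eqv.id_comp f)
  comp_id := by
    rintro n m ⟨f⟩
    exact Quotient.sound (Circ.Eqv.comp_id f)
  assoc := by
    rintro n m k l ⟨f⟩ ⟨g⟩ ⟨h⟩
    exact Quotient.sound (Circ.Eqv.assoc f g h)

/-- The map of `TOF` given by a circuit. -/
def mk {n m : ℕ} (f : Circ n m) : of n ⟶ of m := Quotient.mk _ f

open MonoidalCategory

/-- The map of `TOF` given by a bijection of wires. -/
def permIso {n m : ℕ} (σ : Fin n ≃ Fin m) : of n ≅ of m where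
  hom := mk (Circ.perm σ)
  inv := mk (Circ.perm σ.symm)
  hom_inv_id := Quotient.sound ((Circ.Eqv.perm_comp σ σ.symm).trans (by
    rw [Equiv.self_trans_symm]; exact Circ.Eqv.refl _))
  inv_hom_id := Quotient.sound ((Circ.Eqv.perm_comp σ.symm σ).trans (by
    rw [Equiv.symm_trans_self]; exact Circ.Eqv.refl _))

/-- Juxtaposition of maps of `TOF`. -/
def tensorMap {n m n' m' : ℕ} (f : of n ⟶ of m) (g : of n' ⟶ of m') : of (n + n') ⟶ of (m + m') :=
  Quotient.map₂ Circ.tensor (fun _ _ h _ _ h' => Circ.Eqv.tensor_congr h h') f g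

lemma permIso_comp {n m k : ℕ} (σ : Fin n ≃ Fin m) (τ : Fin m ≃ Fin k) :
    (permIso σ).hom ≫ (permIso τ).hom = (permIso (σ.trans τ)).hom :=
  Quotient.sound (Circ.Eqv.perm_comp σ τ)

lemma permIso_tensor {n m n' m' : ℕ} (σ : Fin n ≃ Fin m) (τ : Fin n' ≃ Fin m') :
    tensorMap (permIso σ).hom (permIso τ).hom = (permIso (Circ.sumPerm σ τ)).hom :=
  Quotient.sound (Circ.Eqv.perm_tensor σ τ)

lemma id_eq_permIso (n : ℕ) : 𝟙 (of n) = (permIso (Equiv.refl (Fin n))).hom := rfl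

lemma tensorMap_comp {n m k n' m' k' : ℕ} (f : of n ⟶ of m) (f' : of n' ⟶ of m')
    (g : of m ⟶ of k) (g' : of m' ⟶ of k') :
    tensorMap (f ≫ g) (f' ≫ g') = tensorMap f f' ≫ tensorMap g g' := by
  induction f using Quotient.ind
  induction g using Quotient.ind
  induction f' using Quotient.ind
  induction g' using Quotient.ind
  exact Quotient.sound (Circ.Eqv.interchange _ _ _ _)

lemma tensorMap_id (n m : ℕ) : tensorMap (𝟙 (of n)) (𝟙 (of m)) = 𝟙 (of (n + m)) := by
  rw [id_eq_permIso, id_eq_permIso, id_eq_permIso, permIso_tensor]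
  congr 2
  simp [Circ.sumPerm]

lemma val_sumPerm {n m n' m' : ℕ} (σ : Fin n ≃ Fin m) (τ : Fin n' ≃ Fin m') (i : Fin (n + n')) :
    (Circ.sumPerm σ τ i : ℕ) =
      if h : i.val < n then (σ ⟨i, h⟩ : ℕ) else m + τ ⟨i - n, by omega⟩ := by
  induction i using Fin.addCases with
  | left i => simp [Circ.sumPerm]
  | right i => simp [Circ.sumPerm]

lemma val_finAddFlip {n m : ℕ} (i : Fin (n + m)) :
    (finAddFlip i : ℕ) = if i.val < n then m + i else i - n := by
  induction i using Fin.addCases with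
  | left i => simp
  | right i => simp

lemma pentagon_aux (a b c d : ℕ) :
    tensorMap (permIso (finCongr (Nat.add_assoc a b c))).hom (𝟙 (of d)) ≫
      (permIso (finCongr (Nat.add_assoc a (b + c) d))).hom ≫
      tensorMap (𝟙 (of a)) (permIso (finCongr (Nat.add_assoc b c d))).hom =
    (permIso (finCongr (Nat.add_assoc (a + b) c d))).hom ≫
      (permIso (finCongr (Nat.add_assoc a b (c + d)))).hom := by
  rw [id_eq_permIso, id_eq_permIso, permIso_tensor, permIso_tensor, permIso_comp, permIso_comp,
    permIso_comp]
  congr 2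
  ext i
  simp [val_sumPerm]
  grind

lemma triangle_aux (a b : ℕ) :
    (permIso (finCongr (Nat.add_assoc a 0 b))).hom ≫
      tensorMap (𝟙 (of a)) (permIso (finCongr (Nat.zero_add b))).hom =
    tensorMap (permIso (finCongr (Nat.add_zero a))).hom (𝟙 (of b)) := by
  rw [id_eq_permIso, id_eq_permIso, permIso_tensor, permIso_tensor, permIso_comp]
  congr 2
  ext i
  simp [val_sumPerm]

lemma hexagon_aux (a b c : ℕ) :
    (permIso (finCongr (Nat.add_assoc a b c))).hom ≫
      (permIso (finAddFlip (m := a) (n := b + c))).hom ≫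
      (permIso (finCongr (Nat.add_assoc b c a))).hom =
    tensorMap (permIso (finAddFlip (m := a) (n := b))).hom (𝟙 (of c)) ≫
      (permIso (finCongr (Nat.add_assoc b a c))).hom ≫
      tensorMap (𝟙 (of b)) (permIso (finAddFlip (m := a) (n := c))).hom := by
  rw [id_eq_permIso, id_eq_permIso, permIso_tensor, permIso_tensor, permIso_comp, permIso_comp,
    permIso_comp, permIso_comp]
  congr 2
  ext i
  simp [val_sumPerm, val_finAddFlip]
  grind

lemma hexagon_aux' (a b c : ℕ) :
    (permIso (finCongr (Nat.add_assoc a b c))).inv ≫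
      (permIso (finAddFlip (m := a + b) (n := c))).hom ≫
      (permIso (finCongr (Nat.add_assoc c a b))).inv =
    tensorMap (𝟙 (of a)) (permIso (finAddFlip (m := b) (n := c))).hom ≫
      (permIso (finCongr (Nat.add_assoc a c b))).inv ≫
      tensorMap (permIso (finAddFlip (m := a) (n := c))).hom (𝟙 (of b)) := by
  change (permIso (Equiv.symm _)).hom ≫ _ ≫ (permIso (Equiv.symm _)).hom =
    _ ≫ (permIso (Equiv.symm _)).hom ≫ _
  rw [id_eq_permIso, id_eq_permIso, permIso_tensor, permIso_tensor, permIso_comp, permIso_comp,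
    permIso_comp, permIso_comp]
  congr 2
  ext i
  simp [val_sumPerm, val_finAddFlip]
  grind

lemma symmetry_aux (a b : ℕ) :
    (permIso (finAddFlip (m := a) (n := b))).hom ≫ (permIso (finAddFlip (m := b) (n := a))).hom =
      𝟙 (of (a + b)) := by
  rw [id_eq_permIso, permIso_comp]
  congr 2
  ext i
  simp [val_finAddFlip]
  grind

instance : MonoidalCategoryStruct TOF where
  tensorObj n m := Nat.add n m
  tensorUnit := of 0
  tensorHom f g := tensorMap f g
  whiskerLeft n _ _ f := tensorMap (𝟙 n) f
  whiskerRight f n := tensorMap f (𝟙 n)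
  associator n m k := permIso (finCongr (Nat.add_assoc n m k))
  leftUnitor n := permIso (finCongr (Nat.zero_add n))
  rightUnitor n := permIso (finCongr (Nat.add_zero n))

instance : MonoidalCategory TOF := MonoidalCategory.ofTensorHom
  (id_tensorHom_id := tensorMap_id)
  (id_tensorHom := fun _ _ _ _ => rfl)
  (tensorHom_id := fun _ _ => rfl)
  (tensorHom_comp_tensorHom := fun f g h k => (tensorMap_comp f g h k).symm)
  (associator_naturality := by
    rintro _ _ _ _ _ _ ⟨f⟩ ⟨g⟩ ⟨h⟩
    exact Quotient.sound (Circ.Eqv.tensor_assoc f g h))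
  (leftUnitor_naturality := by
    rintro _ _ ⟨f⟩
    exact Quotient.sound (Circ.Eqv.id_tensor f))
  (rightUnitor_naturality := by
    rintro _ _ ⟨f⟩
    exact Quotient.sound (Circ.Eqv.tensor_id f))
  (pentagon := pentagon_aux)
  (triangle := triangle_aux)

instance : SymmetricCategory TOF where
  braiding n m := permIso (finAddFlip (m := n) (n := m))
  braiding_naturality_left := by
    rintro (n : ℕ) (m : ℕ) ⟨f⟩ (k : ℕ)
    exact Quotient.sound (Circ.Eqv.braid f (Circ.id k))
  braiding_naturality_right := by
    rintro (k : ℕ) (n : ℕ) (m : ℕ) ⟨f⟩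
    exact Quotient.sound (Circ.Eqv.braid (Circ.id k) f)
  hexagon_forward := hexagon_aux
  hexagon_reverse := hexagon_aux'
  symmetry := symmetry_aux

/-- `⊕_x^X`: the not gate on the wire `x` of an `n`-wire circuit, controlled by the wires in `X`. -/
noncomputable def mcx {n : ℕ} (X : Finset (Fin n)) (x : Fin n) (hx : x ∉ X) : of n ⟶ of n :=
  mk ((Circ.cnotN X.card).on (Circ.ctrlWires X x hx))

/-- `▷_x`: the ancilla `|0⟩` on the wire `x`, which is thereby added to the other `n` wires. -/
def zeroKet {n : ℕ} (x : Fin (n + 1)) : of n ⟶ of (n + 1) := mk (Circ.insertAt Circ.ket0 x)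

end TOF

/-! Ancillae are traded for equations in a monoid. The circuits on `n` wires form the monoid `Op n`,
and `place e` is a monoid homomorphism, functorial in the embedding `e`. Let `Z w` and `O w`
terminate the wire `w` and create it again, in state 0 or in state 1. Since creating and then
terminating a wire in the same state is the identity, `f = g` may be checked beside a fresh wire
`w`, as `Z w * f = Z w * g` or as `O w * f = O w * g` (`cancel_Z`, `cancel_O`).

A wire in state 1 may be added to the controls of a gate (`O_mul_pad`, `O_mul_mc`), so identities
for gates with few controls follow from those for gates with more. A fresh wire in state 0 may
absorb two controls: beside `Z z`, the gate with controls `a, b, l` is the gate with controls `z, l`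
conjugated by the Toffoli gate from `a, b` to `z` (`Z_mul_gate`). This lowers the number of controls
and drives the inductions.

The recursive definition gives this formula only with a second `Z z` on the right (`Z_gate_Z`). That
weak form already yields all commutations (`gate_commute`), and commutation then removes the second
projection (`Z_mul_mul_Z`). Next comes symmetry in the controls (`gate_perm`), so that gates can be
indexed by sets (`mc`). Involutivity and absorption by a control in state 0 are inductions (`mc_sq`,
`Z_mul_mc_of_mem`). The product rule `mc_mul_mc` rests on conjugation by a controlled not or a
Toffoli gate (`mc_conj_aux`), and the last identity is the controlled not case beside a target in
state 0. -/

namespace TOF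

/-! ### Placing circuits on chosen wires. -/

/-- The map of `TOF` given by a bijection of wires. -/
def pm {n m : ℕ} (σ : Fin n ≃ Fin m) : of n ⟶ of m := mk (Circ.perm σ)

lemma pm_comp {n m k : ℕ} (σ : Fin n ≃ Fin m) (τ : Fin m ≃ Fin k) :
    pm σ ≫ pm τ = pm (σ.trans τ) := permIso_comp σ τ

lemma pm_comp_assoc {n m k l : ℕ} (σ : Fin n ≃ Fin m) (τ : Fin m ≃ Fin k) (f : of k ⟶ of l) :
    pm σ ≫ pm τ ≫ f = pm (σ.trans τ) ≫ f := by
  rw [← Category.assoc, pm_comp]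

lemma pm_refl (n : ℕ) : pm (Equiv.refl (Fin n)) = 𝟙 (of n) := rfl

lemma tensorMap_pm {n m n' m' : ℕ} (σ : Fin n ≃ Fin m) (τ : Fin n' ≃ Fin m') :
    tensorMap (pm σ) (pm τ) = pm (Circ.sumPerm σ τ) := permIso_tensor σ τ

lemma tensorMap_assoc {n m n' m' n'' m'' : ℕ} (f : of n ⟶ of m) (g : of n' ⟶ of m')
    (h : of n'' ⟶ of m'') :
    tensorMap (tensorMap f g) h ≫ pm (finCongr (Nat.add_assoc m m' m'')) =
      pm (finCongr (Nat.add_assoc n n' n'')) ≫ tensorMap f (tensorMap g h) := by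
  induction f using Quotient.ind
  induction g using Quotient.ind
  induction h using Quotient.ind
  exact Quotient.sound (Circ.Eqv.tensor_assoc _ _ _)

lemma tensorMap_flip {n m n' m' : ℕ} (f : of n ⟶ of m) (g : of n' ⟶ of m') :
    tensorMap f g ≫ pm finAddFlip = pm finAddFlip ≫ tensorMap g f := by
  induction f using Quotient.ind
  induction g using Quotient.ind
  exact Quotient.sound (Circ.Eqv.braid _ _)

lemma tensorMap_id_zero {n m : ℕ} (f : of n ⟶ of m) : tensorMap f (𝟙 (of 0)) = f := by
  have h : tensorMap f (𝟙 (of 0)) ≫ pm (finCongr (Nat.add_zero m)) =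
      pm (finCongr (Nat.add_zero n)) ≫ f := by
    induction f using Quotient.ind
    exact Quotient.sound (Circ.Eqv.tensor_id _)
  exact (Category.comp_id _).symm.trans (h.trans (Category.id_comp f))

lemma id_tensorMap_succ (f : of 1 ⟶ of 1) : tensorMap (𝟙 (of 0)) f = f := by
  have h : tensorMap (𝟙 (of 0)) f ≫ pm (finCongr (Nat.zero_add 1)) =
      pm (finCongr (Nat.zero_add 1)) ≫ f := by
    induction f using Quotient.ind
    exact Quotient.sound (Circ.Eqv.id_tensor _)
  exact (Category.comp_id _).symm.trans (h.trans (Category.id_comp f))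

/-- The circuits with `n` input and `n` output wires, up to equality in `TOF`. -/
abbrev Op (n : ℕ) : Type := of n ⟶ of n

instance (n : ℕ) : Monoid (Op n) where
  mul f g := f ≫ g
  one := 𝟙 (of n)
  mul_assoc f g h := Category.assoc f g h
  one_mul f := Category.id_comp f
  mul_one f := Category.comp_id f

lemma Op.mul_def {n : ℕ} (f g : Op n) : f * g = f ≫ g := rfl

lemma Op.one_def (n : ℕ) : (1 : Op n) = 𝟙 (of n) := rfl

/-- The class of a circuit. -/
def op {n : ℕ} (f : Circ n n) : Op n := mk f

lemma wireEquiv_castAdd {k n : ℕ} (w : Fin k ↪ Fin n) (i : Fin k) :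
    Circ.wireEquiv w (Fin.castAdd _ i) = w i := by
  simp only [Circ.wireEquiv, Equiv.trans_apply, finSumFinEquiv_symm_apply_castAdd,
    Equiv.sumCongr_apply, Sum.map_inl, Equiv.sumCompl_apply_inl]
  rfl

/-- A circuit on `k` wires placed on the wires `e 0, …, e (k - 1)` of a circuit with `n` wires. -/
noncomputable def place {k n : ℕ} (e : Fin k ↪ Fin n) : Op k →* Op n where
  toFun f := (pm (Circ.wireEquiv e).symm ≫ tensorMap f (𝟙 (of (n - k)))) ≫ pm (Circ.wireEquiv e)
  map_one' := by
    rw [Op.one_def, tensorMap_id, Category.comp_id, pm_comp, Equiv.symm_trans_self]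
    rfl
  map_mul' f g := by
    have h : tensorMap (f * g) (𝟙 (of (n - k))) =
        tensorMap f (𝟙 (of (n - k))) ≫ tensorMap g (𝟙 (of (n - k))) := by
      rw [← tensorMap_comp, Category.comp_id]; rfl
    rw [h, Op.mul_def]
    simp only [Category.assoc]
    rw [pm_comp_assoc, Equiv.self_trans_symm, pm_refl, Category.id_comp]

lemma exists_sumPerm_eq {k m m' : ℕ} (ρ : Fin (k + m) ≃ Fin (k + m'))
    (h : ∀ i, ρ (Fin.castAdd m i) = Fin.castAdd m' i) :
    ∃ τ : Fin m ≃ Fin m', ρ = Circ.sumPerm (Equiv.refl _) τ := by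
  have h' : ∀ i, ρ.symm (Fin.castAdd m' i) = Fin.castAdd m i := fun i => by
    rw [← h, Equiv.symm_apply_apply]
  have h1 : ∀ j : Fin m, ∃ j' : Fin m', ρ (Fin.natAdd k j) = Fin.natAdd k j' := fun j => by
    generalize hx : ρ (Fin.natAdd k j) = x
    induction x using Fin.addCases with
    | left i =>
      rw [← h, ρ.apply_eq_iff_eq] at hx
      have := congrArg Fin.val hx
      simp at this
      omega
    | right i => exact ⟨i, rfl⟩
  have h2 : ∀ j : Fin m', ∃ j' : Fin m, ρ.symm (Fin.natAdd k j) = Fin.natAdd k j' := fun j => by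
    generalize hx : ρ.symm (Fin.natAdd k j) = x
    induction x using Fin.addCases with
    | left i =>
      rw [← h', ρ.symm.apply_eq_iff_eq] at hx
      have := congrArg Fin.val hx
      simp at this
      omega
    | right i => exact ⟨i, rfl⟩
  choose t ht using h1
  choose s hs using h2
  have inj : ∀ {p : ℕ} {a b : Fin p}, Fin.natAdd k a = Fin.natAdd k b → a = b :=
    fun {p} {a b} hab => Fin.ext (by have := congrArg Fin.val hab; simpa using this)
  refine ⟨⟨t, s, fun j => inj ?_, fun j => inj ?_⟩, ?_⟩
  · rw [← hs, ← ht, Equiv.symm_apply_apply]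
  · rw [← ht, ← hs, Equiv.apply_symm_apply]
  · ext x : 1
    induction x using Fin.addCases with
    | left i => rw [h]; simp [Circ.sumPerm]
    | right i => rw [ht]; simp [Circ.sumPerm]

/-- Any bijection extending `e` computes the placement: two extensions differ by a permutation of
the remaining wires, which slides past `f` tensored with the identity. -/
lemma place_eq {k m n : ℕ} (e : Fin k ↪ Fin n) (σ : Fin (k + m) ≃ Fin n)
    (h : ∀ i, σ (Fin.castAdd m i) = e i) (f : Op k) :
    place e f = pm σ.symm ≫ tensorMap f (𝟙 (of m)) ≫ pm σ := by
  obtain ⟨τ, hτ⟩ := exists_sumPerm_eq (σ.trans (Circ.wireEquiv e).symm) (fun i => by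
    rw [Equiv.trans_apply, h, Equiv.symm_apply_eq, wireEquiv_castAdd])
  have hσ : σ = (Circ.sumPerm (Equiv.refl _) τ).trans (Circ.wireEquiv e) := by
    rw [← hτ, Equiv.trans_assoc, Equiv.symm_trans_self, Equiv.trans_refl]
  have key : tensorMap f (𝟙 (of m)) ≫ pm (Circ.sumPerm (Equiv.refl _) τ) =
      pm (Circ.sumPerm (Equiv.refl _) τ) ≫ tensorMap f (𝟙 (of (n - k))) := by
    rw [← tensorMap_pm, ← tensorMap_comp, ← tensorMap_comp, Category.id_comp, Category.comp_id,
      pm_refl, Category.id_comp, Category.comp_id]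
  rw [hσ, ← pm_comp, ← Category.assoc (tensorMap _ _), key, Category.assoc, pm_comp_assoc,
    ← hσ]
  have hp : place e f = (pm (Circ.wireEquiv e).symm ≫ tensorMap f (𝟙 (of (n - k)))) ≫
    pm (Circ.wireEquiv e) := rfl
  rw [hp, Category.assoc]
  congr 2
  ext x : 1
  rw [hσ]
  simp

lemma place_castAddEmb {k m : ℕ} (f : Op k) :
    place (Fin.castAddEmb m) f = tensorMap f (𝟙 (of m)) := by
  rw [place_eq (Fin.castAddEmb m) (Equiv.refl (Fin (k + m))) (fun i => rfl)]
  exact (Category.id_comp _).trans (Category.comp_id _)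

lemma place_natAddEmb {k m : ℕ} (f : Op k) :
    place (Fin.natAddEmb m) f = tensorMap (𝟙 (of m)) f := by
  rw [place_eq (Fin.natAddEmb m) (finAddFlip : Fin (k + m) ≃ Fin (m + k)) (fun i => by simp)]
  rw [tensorMap_flip, pm_comp_assoc, Equiv.symm_trans_self, pm_refl, Category.id_comp]

lemma place_toEmbedding {n : ℕ} (σ : Fin n ≃ Fin n) (f : Op n) :
    place σ.toEmbedding f = pm σ.symm ≫ f ≫ pm σ := by
  rw [place_eq (m := 0) σ.toEmbedding σ (fun i => rfl), tensorMap_id_zero]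

lemma place_place {k m n : ℕ} (e : Fin k ↪ Fin m) (e' : Fin m ↪ Fin n) (f : Op k) :
    place e' (place e f) = place (e.trans e') f := by
  rw [place_eq (e.trans e') ((finCongr (Nat.add_assoc k (m - k) (n - m))).symm.trans
    ((Circ.sumPerm (Circ.wireEquiv e) (Equiv.refl (Fin (n - m)))).trans (Circ.wireEquiv e')))
    (fun i => ?_)]
  · change ((_ ≫ tensorMap ((_ ≫ _) ≫ _) _) ≫ _) = _
    have h1 : ∀ (a : of m ⟶ of (k + (m - k))) (b : of (k + (m - k)) ⟶ of (k + (m - k)))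
        (c : of (k + (m - k)) ⟶ of m), tensorMap ((a ≫ b) ≫ c) (𝟙 (of (n - m))) =
          tensorMap a (𝟙 _) ≫ tensorMap b (𝟙 _) ≫ tensorMap c (𝟙 _) := fun a b c => by
      rw [← tensorMap_comp, ← tensorMap_comp, Category.id_comp, Category.id_comp, Category.assoc]
    have h2 : tensorMap (tensorMap f (𝟙 (of (m - k)))) (𝟙 (of (n - m))) =
        pm (finCongr (Nat.add_assoc k (m - k) (n - m))) ≫ tensorMap f (𝟙 _) ≫
          pm (finCongr (Nat.add_assoc k (m - k) (n - m))).symm := by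
      rw [← tensorMap_id, ← Category.assoc, ← tensorMap_assoc, Category.assoc, pm_comp,
        Equiv.self_trans_symm, pm_refl, Category.comp_id]
    rw [h1, h2, ← pm_refl (n - m), tensorMap_pm, tensorMap_pm]
    simp only [Category.assoc]
    rw [pm_comp_assoc, pm_comp_assoc, pm_comp, pm_comp]
    rfl
  · rw [Equiv.trans_apply, Equiv.trans_apply]
    have : (finCongr (Nat.add_assoc k (m - k) (n - m))).symm (Fin.castAdd (m - k + (n - m)) i) =
        Fin.castAdd (n - m) (Fin.castAdd (m - k) i) := rfl
    rw [this]
    have h3 : Circ.sumPerm (Circ.wireEquiv e) (Equiv.refl (Fin (n - m)))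
        (Fin.castAdd (n - m) (Fin.castAdd (m - k) i)) = Fin.castAdd _ (e i) := by
      simp [Circ.sumPerm, wireEquiv_castAdd]
    rw [h3, wireEquiv_castAdd]
    rfl

/-- Both placements factor through one embedding of `k + l` wires, where this is the interchange
law. -/
lemma place_commute {k l n : ℕ} (e : Fin k ↪ Fin n) (e' : Fin l ↪ Fin n)
    (h : ∀ i j, e i ≠ e' j) (f : Op k) (g : Op l) : Commute (place e f) (place e' g) := by
  let E : Fin (k + l) ↪ Fin n := ⟨Fin.append e e',
    Fin.append_injective_iff.2 ⟨e.injective, e'.injective, h⟩⟩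
  have h1 : e = (Fin.castAddEmb l).trans E := by
    ext i : 1; simp [E]
  have h2 : e' = (Fin.natAddEmb k).trans E := by
    ext i : 1; simp [E]
  rw [h1, h2, ← place_place, ← place_place]
  refine Commute.map ?_ (place E)
  rw [place_castAddEmb, place_natAddEmb]
  change tensorMap _ _ ≫ tensorMap _ _ = tensorMap _ _ ≫ tensorMap _ _
  rw [← tensorMap_comp, ← tensorMap_comp, Category.id_comp, Category.id_comp, Category.comp_id,
    Category.comp_id]

/-! ### Ancillae, cancellation and the projections `O` and `Z`. -/

/-- Creation of the wire `z` by an input ancilla. -/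
def ins {n : ℕ} (κ : of 0 ⟶ of 1) (z : Fin (n + 1)) : of n ⟶ of (n + 1) :=
  tensorMap (𝟙 (of n)) κ ≫ pm (Circ.lastTo z)

/-- Termination of the wire `z` by an output ancilla. -/
def rem {n : ℕ} (β : of 1 ⟶ of 0) (z : Fin (n + 1)) : of (n + 1) ⟶ of n :=
  pm (Circ.lastTo z).symm ≫ tensorMap (𝟙 (of n)) β

lemma lastTo_castAdd {n : ℕ} (z : Fin (n + 1)) (i : Fin n) :
    Circ.lastTo z (Fin.castAdd 1 i) = z.succAbove i := by
  have : Fin.castAdd 1 i = (Fin.last n).succAbove i := by simp; rfl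
  rw [Circ.lastTo, Equiv.trans_apply, this, finSuccEquiv'_succAbove, finSuccEquiv'_symm_some]

lemma lastTo_last {n : ℕ} (z : Fin (n + 1)) : Circ.lastTo z (Fin.last n) = z := by
  rw [Circ.lastTo, Equiv.trans_apply, finSuccEquiv'_at, finSuccEquiv'_symm_none]

lemma ins_place {n : ℕ} (κ : of 0 ⟶ of 1) (z : Fin (n + 1)) (f : Op n) :
    ins κ z ≫ place z.succAboveEmb f =
      f ≫ ins κ z := by
  rw [place_eq z.succAboveEmb (Circ.lastTo z) (lastTo_castAdd z), ins, Category.assoc,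
    pm_comp_assoc, Equiv.self_trans_symm, pm_refl, Category.id_comp, ← Category.assoc,
    ← tensorMap_comp, Category.id_comp, Category.comp_id, ← Category.assoc]
  congr 1
  nth_rw 1 [← Category.comp_id f, ← Category.id_comp κ]
  rw [tensorMap_comp, tensorMap_id_zero]

lemma ins_rem {n : ℕ} {κ : of 0 ⟶ of 1} {β : of 1 ⟶ of 0} (h : κ ≫ β = 𝟙 (of 0))
    (z : Fin (n + 1)) : ins κ z ≫ rem β z = 𝟙 (of n) := by
  rw [ins, rem, Category.assoc, pm_comp_assoc, Equiv.self_trans_symm, pm_refl, Category.id_comp,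
    ← tensorMap_comp, h, Category.id_comp]
  exact tensorMap_id n 0

/-- The embedding with value `z`. -/
def single {n : ℕ} (z : Fin n) : Fin 1 ↪ Fin n := ⟨fun _ => z, fun i j _ => Subsingleton.elim i j⟩

lemma rem_ins {n : ℕ} (κ : of 0 ⟶ of 1) (β : of 1 ⟶ of 0) (z : Fin (n + 1)) :
    rem β z ≫ ins κ z = place (single z) (β ≫ κ) := by
  rw [place_eq (single z) ((finAddFlip : Fin (1 + n) ≃ Fin (n + 1)).trans (Circ.lastTo z))
    (fun i => ?_)]
  · rw [← pm_comp, ← Category.assoc (tensorMap _ _), tensorMap_flip, Category.assoc,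
      pm_comp_assoc, rem, ins, Category.assoc, ← Category.assoc (tensorMap _ _), ← tensorMap_comp,
      Category.id_comp]
    congr 2
    ext x : 1
    simp
  · rw [Equiv.trans_apply, finAddFlip_apply_castAdd]
    have : Fin.natAdd n i = Fin.last n := by ext; simp
    rw [this, lastTo_last]; rfl

/-- Sandwiching the hypothesis between creation and termination of `z` removes every ancilla, since
`κ ≫ β` is trivial. -/
lemma place_cancel {n : ℕ} {κ : of 0 ⟶ of 1} {β : of 1 ⟶ of 0} (h : κ ≫ β = 𝟙 (of 0))
    (z : Fin (n + 1)) {f g : Op n}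
    (hfg : place (single z) (β ≫ κ) * place z.succAboveEmb f =
      place (single z) (β ≫ κ) * place z.succAboveEmb g) : f = g := by
  rw [← rem_ins, Op.mul_def, Op.mul_def, Category.assoc, Category.assoc, ins_place, ins_place]
    at hfg
  have := congrArg (fun q : of (n + 1) ⟶ of (n + 1) => ins κ z ≫ q ≫ rem β z) hfg
  simp only [Category.assoc] at this
  simpa only [ins_rem h, Category.comp_id, ← Category.assoc, Category.id_comp] using this

/-- Turns a circuit with an internal ancilla, such as the recursive definition of `cnotN`, into a
product in the monoid. -/
lemma place_compress {n : ℕ} (κ : of 0 ⟶ of 1) (β : of 1 ⟶ of 0) (z : Fin (n + 1))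
    (U : Op (n + 1)) :
    place (single z) (β ≫ κ) * place z.succAboveEmb
      (ins κ z ≫ U ≫ rem β z) =
      place (single z) (β ≫ κ) * U * place (single z) (β ≫ κ) := by
  rw [← rem_ins, Op.mul_def, Op.mul_def, Op.mul_def, Category.assoc, ins_place]
  simp only [Category.assoc]

/-- The projection of the wire `z` onto the state `|1⟩`. -/
noncomputable def O {n : ℕ} (z : Fin n) : Op n := place (single z) (mk Circ.bra1 ≫ mk Circ.ket1)

/-- The projection of the wire `z` onto the state `|0⟩`. -/
noncomputable def Z {n : ℕ} (z : Fin n) : Op n := place (single z) (mk Circ.bra0 ≫ mk Circ.ket0)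

lemma single_trans {n m : ℕ} (z : Fin n) (e : Fin n ↪ Fin m) :
    (single z).trans e = single (e z) := rfl

lemma place_O {n m : ℕ} (e : Fin n ↪ Fin m) (z : Fin n) : place e (O z) = O (e z) := by
  rw [O, place_place, single_trans, O]

lemma place_Z {n m : ℕ} (e : Fin n ↪ Fin m) (z : Fin n) : place e (Z z) = Z (e z) := by
  rw [Z, place_place, single_trans, Z]

/-! ### Gates indexed by lists of controls. -/

open scoped Classical in
/-- The multiply controlled not gate with list of controls `l` and target `x`; by convention it is
the identity if these wires are not distinct. -/
noncomputable def gate {n : ℕ} (l : List (Fin n)) (x : Fin n) : Op n :=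
  if h : Function.Injective (Fin.snoc (α := fun _ => Fin n) l.get x) then
    place ⟨_, h⟩ (op (Circ.cnotN l.length)) else 1

lemma snoc_get_injective_iff {n : ℕ} {l : List (Fin n)} {x : Fin n} :
    Function.Injective (Fin.snoc (α := fun _ => Fin n) l.get x) ↔ l.Nodup ∧ x ∉ l := by
  rw [Fin.snoc_injective_iff, List.nodup_iff_injective_get]
  simp only [Set.mem_range, List.mem_iff_get]

lemma gate_of_not {n : ℕ} {l : List (Fin n)} {x : Fin n} (h : ¬ (l.Nodup ∧ x ∉ l)) :
    gate l x = 1 := by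
  rw [gate, dif_neg (mt snoc_get_injective_iff.1 h)]

lemma gate_eq_place {n k : ℕ} (l : List (Fin n)) (x : Fin n) (w : Fin (k + 1) ↪ Fin n)
    (hk : l.length = k) (hl : ∀ i : Fin k, w i.castSucc = l.get (i.cast hk.symm))
    (hx : w (Fin.last k) = x) : gate l x = place w (op (Circ.cnotN k)) := by
  subst hk
  have hw : (w : Fin (l.length + 1) → Fin n) = Fin.snoc (α := fun _ => Fin n) l.get x := by
    funext i
    induction i using Fin.lastCases with
    | last => rw [hx, Fin.snoc_last]
    | cast i => rw [hl, Fin.snoc_castSucc]; rfl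
  rw [gate, dif_pos (hw ▸ w.injective)]
  congr 2
  ext i : 1
  exact (congrFun hw i).symm

lemma place_gate {n m : ℕ} (e : Fin n ↪ Fin m) (l : List (Fin n)) (x : Fin n) :
    place e (gate l x) = gate (l.map e) (e x) := by
  by_cases h : l.Nodup ∧ x ∉ l
  · have h' := snoc_get_injective_iff.2 h
    rw [gate, dif_pos h', place_place]
    refine (gate_eq_place _ _ _ (by simp) (fun i => ?_) ?_).symm
    · simp
    · simp
  · rw [gate_of_not h, gate_of_not, map_one]
    rintro ⟨h1, h2⟩
    exact h ⟨h1.of_map, fun hx => h2 (List.mem_map_of_mem hx)⟩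

lemma gate_two {n : ℕ} {a b x : Fin n} (h : Function.Injective ![a, b, x]) :
    gate [a, b] x = place ⟨![a, b, x], h⟩ (op Circ.tof) :=
  gate_eq_place (k := 2) _ _ _ rfl (fun i => by fin_cases i <;> rfl) rfl

lemma gate_one {n : ℕ} {a x : Fin n} (h : Function.Injective ![a, x]) :
    gate [a] x = place ⟨![a, x], h⟩ (op Circ.cnot) :=
  gate_eq_place (k := 1) _ _ _ rfl (fun i => by fin_cases i; rfl) rfl

lemma gate_nil {n : ℕ} (x : Fin n) : gate [] x = place (single x) (op Circ.not) :=
  gate_eq_place (k := 0) _ _ _ rfl (fun i => i.elim0) rfl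

lemma op_tofOn {n : ℕ} {a b c : Fin n} (h : Function.Injective ![a, b, c]) :
    op (Circ.tofOn a b c h) = gate [a, b] c := (gate_two h).symm

lemma op_cnotOn {n : ℕ} {a c : Fin n} (h : Function.Injective ![a, c]) :
    op (Circ.cnotOn a c h) = gate [a] c := (gate_one h).symm

lemma commute_single {n : ℕ} {z x : Fin n} {l : List (Fin n)} (hz : z ∉ l) (hx : z ≠ x)
    (f : Op 1) : Commute (place (single z) f) (gate l x) := by
  rw [gate]
  split_ifs with h
  · refine place_commute _ _ (fun i j => ?_) _ _
    change z ≠ Fin.snoc (α := fun _ => Fin n) l.get x j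
    induction j using Fin.lastCases with
    | last => rwa [Fin.snoc_last]
    | cast j => rw [Fin.snoc_castSucc]; rintro rfl; exact hz (List.get_mem _ _)
  · exact Commute.one_right _

lemma commute_O {n : ℕ} {z x : Fin n} {l : List (Fin n)} (hz : z ∉ l) (hx : z ≠ x) :
    Commute (O z) (gate l x) := commute_single hz hx _

lemma commute_Z {n : ℕ} {z x : Fin n} {l : List (Fin n)} (hz : z ∉ l) (hx : z ≠ x) :
    Commute (Z z) (gate l x) := commute_single hz hx _

lemma commute_Z_Z {n : ℕ} (z w : Fin n) : Commute (Z z) (Z w) := by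
  by_cases h : z = w
  · rw [h]
  · exact place_commute _ _ (fun _ _ => h) _ _

lemma commute_O_Z {n : ℕ} {z w : Fin n} (h : z ≠ w) : Commute (O z) (Z w) :=
  place_commute _ _ (fun _ _ => h) _ _

lemma commute_O_O {n : ℕ} (z w : Fin n) : Commute (O z) (O w) := by
  by_cases h : z = w
  · rw [h]
  · exact place_commute _ _ (fun _ _ => h) _ _

/-! ### Control wires in a known state, and padding by a control in state 1. -/

lemma ket1_bra1 : mk Circ.ket1 ≫ mk Circ.bra1 = 𝟙 (of 0) := Quotient.sound Circ.Eqv.tof9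

/-- The inclusion of the wires of a circuit into those of the circuit with one more wire. -/
def up {n : ℕ} : Fin n ↪ Fin (n + 1) := (Fin.last n).succAboveEmb

lemma up_ne_last {n : ℕ} (i : Fin n) : up i ≠ Fin.last n := Fin.succAbove_ne _ _

lemma last_ne_up {n : ℕ} (i : Fin n) : Fin.last n ≠ up i := Fin.ne_succAbove _ _

lemma last_notMem_map_up {n : ℕ} (l : List (Fin n)) : Fin.last n ∉ l.map up := by
  simp [up_ne_last]

lemma cancel_O {n : ℕ} {f g : Op n}
    (h : O (Fin.last n) * place up f = O (Fin.last n) * place up g) : f = g :=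
  place_cancel ket1_bra1 _ h

lemma O_mul_O {n : ℕ} (z : Fin n) : O z * O z = O z := by
  rw [O, ← map_mul, Op.mul_def, Category.assoc, ← Category.assoc (mk Circ.ket1), ket1_bra1,
    Category.id_comp]

lemma single_zero (k : ℕ) : single (0 : Fin (1 + k)) = Fin.castAddEmb k := by
  ext i
  fin_cases i
  rfl

lemma tensorMap_id_comp {n m k l : ℕ} (f : of n ⟶ of m) (g : of m ⟶ of k) :
    tensorMap (f ≫ g) (𝟙 (of l)) = tensorMap f (𝟙 (of l)) ≫ tensorMap g (𝟙 (of l)) := by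
  rw [← tensorMap_comp, Category.comp_id]

lemma place_single_zero {k : ℕ} (f : Op 1) :
    place (single (0 : Fin (1 + k))) f = tensorMap f (𝟙 (of k)) := by
  rw [single_zero, place_castAddEmb]

lemma op_tof : op Circ.tof = gate [(0 : Fin 3), 1] 2 := by
  have h : Function.Injective ![(0 : Fin 3), 1, 2] := by decide
  have h' : (⟨![(0 : Fin 3), 1, 2], h⟩ : Fin 3 ↪ Fin 3) = (Equiv.refl (Fin 3)).toEmbedding := by
    ext i; fin_cases i <;> rfl
  rw [gate_two h, h', place_toEmbedding]
  exact ((Category.id_comp _).trans (Category.comp_id _)).symm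

lemma op_cnot : op Circ.cnot = gate [(0 : Fin 2)] 1 := by
  have h : Function.Injective ![(0 : Fin 2), 1] := by decide
  have h' : (⟨![(0 : Fin 2), 1], h⟩ : Fin 2 ↪ Fin 2) = (Equiv.refl (Fin 2)).toEmbedding := by
    ext i; fin_cases i <;> rfl
  rw [gate_one h, h', place_toEmbedding]
  exact ((Category.id_comp _).trans (Category.comp_id _)).symm

lemma op_not : op Circ.not = gate [] (0 : Fin 1) := by
  have h' : single (0 : Fin 1) = (Equiv.refl (Fin 1)).toEmbedding := by
    ext i; fin_cases i; rfl
  rw [gate_nil, h', place_toEmbedding]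
  exact ((Category.id_comp _).trans (Category.comp_id _)).symm

lemma O_mul_tof_aux : O (0 : Fin 3) * gate [0, 1] 2 = O 0 * gate [1] 2 := by
  have h1 : O (0 : Fin 3) = tensorMap (mk Circ.bra1 ≫ mk Circ.ket1) (𝟙 (of 2)) :=
    place_single_zero (k := 2) _
  have h2 : tensorMap (mk Circ.ket1) (𝟙 (of 2)) ≫ op Circ.tof =
    tensorMap (mk Circ.ket1) (op Circ.cnot) := Quotient.sound Circ.Eqv.tof1
  have h3 : gate [(1 : Fin 3)] 2 = tensorMap (𝟙 (of 1)) (op Circ.cnot) := by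
    rw [gate_one (by decide), ← place_natAddEmb]
    congr 2
    ext i; fin_cases i <;> rfl
  rw [h1, h3, ← op_tof, Op.mul_def, Op.mul_def, tensorMap_id_comp, Category.assoc]
  refine (congrArg _ h2).trans ?_
  refine (tensorMap_comp _ _ _ _).symm.trans (Eq.trans ?_ (congrArg (· ≫ _) (tensorMap_id_comp _ _)))
  refine Eq.trans ?_ (tensorMap_comp _ _ _ _)
  rw [Category.comp_id, Category.id_comp]

lemma tof_mul_O_aux : gate [0, 1] 2 * O (0 : Fin 3) = gate [1] 2 * O 0 := by
  have h1 : O (0 : Fin 3) = tensorMap (mk Circ.bra1 ≫ mk Circ.ket1) (𝟙 (of 2)) :=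
    place_single_zero (k := 2) _
  have h2 : op Circ.tof ≫ tensorMap (mk Circ.bra1) (𝟙 (of 2)) =
    tensorMap (mk Circ.bra1) (op Circ.cnot) := Quotient.sound Circ.Eqv.tof1'
  have h3 : gate [(1 : Fin 3)] 2 = tensorMap (𝟙 (of 1)) (op Circ.cnot) := by
    rw [gate_one (by decide), ← place_natAddEmb]
    congr 2
    ext i; fin_cases i <;> rfl
  rw [h1, h3, ← op_tof, Op.mul_def, Op.mul_def, tensorMap_id_comp]
  refine (Category.assoc _ _ _).symm.trans ((congrArg (· ≫ _) h2).trans ?_)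
  refine (tensorMap_comp _ _ _ _).symm.trans (Eq.trans ?_ (Category.assoc _ _ _))
  refine Eq.trans ?_ (congrArg (· ≫ _) (tensorMap_comp _ _ _ _))
  refine Eq.trans ?_ (tensorMap_comp _ _ _ _)
  rw [Category.comp_id, Category.id_comp, Category.comp_id]

lemma O_mul_cnot_mul_O_aux : O (0 : Fin 2) * gate [0] 1 * O 0 = O 0 * gate [] 1 := by
  have h1 : O (0 : Fin 2) = tensorMap (mk Circ.bra1 ≫ mk Circ.ket1) (𝟙 (of 1)) :=
    place_single_zero (k := 1) _
  have h2 : (tensorMap (mk Circ.ket1) (𝟙 (of 1)) ≫ op Circ.cnot) ≫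
    tensorMap (mk Circ.bra1) (𝟙 (of 1)) = op Circ.not := rfl
  have h3 : gate [] (1 : Fin 2) = tensorMap (𝟙 (of 1)) (op Circ.not) := by
    rw [gate_nil, ← place_natAddEmb]
    congr 2
    ext i; fin_cases i; rfl
  have h4 : tensorMap (mk Circ.bra1) (𝟙 (of 1)) ≫ op Circ.not =
      tensorMap (𝟙 (of 1)) (op Circ.not) ≫ tensorMap (mk Circ.bra1) (𝟙 (of 1)) := by
    rw [← tensorMap_comp, Category.id_comp, Category.comp_id]
    conv_lhs => rw [← id_tensorMap_succ (op Circ.not)]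
    exact (tensorMap_comp _ _ _ _).symm.trans (by rw [Category.comp_id, Category.id_comp])
  have h5 : Commute (O (0 : Fin 2)) (gate [] 1) := commute_O (by simp) (by decide)
  rw [h5.eq, h3, ← op_cnot, h1, Op.mul_def, Op.mul_def, tensorMap_id_comp]
  have h6 := congrArg (fun q => (tensorMap (mk Circ.bra1) (𝟙 (of 1)) ≫ q) ≫
    tensorMap (mk Circ.ket1) (𝟙 (of 1))) h2
  simp only [Category.assoc] at h6 ⊢
  refine h6.trans ?_
  rw [← Category.assoc]
  exact (congrArg (· ≫ _) h4).trans (Category.assoc _ _ _)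

/-- The embedding with the entries of a list as its values. -/
def emb {n : ℕ} (l : List (Fin n)) (h : l.Nodup) : Fin l.length ↪ Fin n :=
  ⟨l.get, List.nodup_iff_injective_get.1 h⟩

lemma O_mul_tof {n : ℕ} {a b x : Fin n} (h : [a, b, x].Nodup) :
    O a * gate [a, b] x = O a * gate [b] x := by
  have := congrArg (place (emb [a, b, x] h)) O_mul_tof_aux
  simp only [map_mul, place_O, place_gate] at this
  exact this

lemma tof_mul_O {n : ℕ} {a b x : Fin n} (h : [a, b, x].Nodup) :
    gate [a, b] x * O a = gate [b] x * O a := by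
  have := congrArg (place (emb [a, b, x] h)) tof_mul_O_aux
  simp only [map_mul, place_O, place_gate] at this
  exact this

lemma O_mul_cnot_mul_O {n : ℕ} {a x : Fin n} (h : [a, x].Nodup) :
    O a * gate [a] x * O a = O a * gate [] x := by
  have := congrArg (place (emb [a, x] h)) O_mul_cnot_mul_O_aux
  simp only [map_mul, place_O, place_gate] at this
  exact this

lemma tof_swap_aux : gate [(0 : Fin 3), 1] 2 = gate [1, 0] 2 := by
  have h : op Circ.tof = (pm (Equiv.swap (0 : Fin 3) 1) ≫ op Circ.tof) ≫
    pm (Equiv.swap (0 : Fin 3) 1) := Quotient.sound Circ.Eqv.tof16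
  have h' := place_toEmbedding (Equiv.swap (0 : Fin 3) 1) (op Circ.tof)
  rw [Equiv.symm_swap, ← Category.assoc, ← h, op_tof, place_gate] at h'
  exact h'.symm

lemma tof_swap {n : ℕ} (a b x : Fin n) : gate [a, b] x = gate [b, a] x := by
  by_cases h : [a, b, x].Nodup
  · have := congrArg (place (emb [a, b, x] h)) tof_swap_aux
    simp only [place_gate] at this
    exact this
  · rw [gate_of_not, gate_of_not] <;> · simp at h ⊢; grind

/-- The definition of `not` only gives this with a second `O a` on the right. Beside a further wire
in state 1 the controlled not becomes a Toffoli gate; with `a` in state 1 this is a controlled not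
that does not meet `a`, so `O a` commutes with it and idempotence supplies the missing factor. -/
lemma O_mul_cnot {n : ℕ} {a x : Fin n} (h : [a, x].Nodup) :
    O a * gate [a] x = O a * gate [] x := by
  rw [← O_mul_cnot_mul_O h]
  apply cancel_O
  have hn : up a ≠ up x := fun h' => by simp at h; exact h (up.injective h')
  simp only [map_mul, place_O, place_gate, List.map_cons, List.map_nil]
  have ha := last_ne_up a
  have hx := last_ne_up x
  have h1 := O_mul_tof (a := Fin.last n) (b := up a) (x := up x) (by simp [*])
  have h2 := tof_mul_O (a := up a) (b := Fin.last n) (x := up x) (by simp [*, ha.symm])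
  have c1 := (commute_O_O (Fin.last n) (up a)).eq
  have c2 : Commute (O (up a)) (gate [Fin.last n] (up x)) := commute_O (by simp [ha.symm]) hn
  have h3 := O_mul_tof (a := up a) (b := Fin.last n) (x := up x) (by simp [*, ha.symm])
  calc O (Fin.last n) * (O (up a) * gate [up a] (up x))
      = O (up a) * (O (Fin.last n) * gate [up a] (up x)) := by
        rw [← mul_assoc, c1, mul_assoc]
    _ = O (Fin.last n) * (O (up a) * gate [up a, Fin.last n] (up x)) := by
        rw [← h1, ← mul_assoc, ← c1, mul_assoc, tof_swap]
    _ = O (Fin.last n) * (O (up a) * gate [up a, Fin.last n] (up x)) * O (up a) := by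
        rw [h3, c2.eq]
        simp only [mul_assoc, O_mul_O]
    _ = _ := by
        rw [tof_swap, ← mul_assoc, c1, mul_assoc (O (up a)), h1, ← mul_assoc, ← c1]
        simp only [mul_assoc]

lemma O_mul_pad {n : ℕ} {w x : Fin n} {l : List (Fin n)} (hl : l.length ≤ 1)
    (h : (w :: l).Nodup) (hx : x ∉ w :: l) : O w * gate (w :: l) x = O w * gate l x := by
  match l, hl with
  | [], _ => exact O_mul_cnot (by simpa using Ne.symm (by simpa using hx))
  | [a], _ =>
    refine O_mul_tof ?_
    simp at h hx ⊢
    grind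

lemma up_pad {n : ℕ} {x : Fin n} {l : List (Fin n)} (hl : l.length ≤ 1) (h : l.Nodup)
    (hx : x ∉ l) : O (Fin.last n) * gate (Fin.last n :: l.map up) (up x) =
      O (Fin.last n) * gate (l.map up) (up x) := by
  refine O_mul_pad (by simpa using hl) ?_ ?_
  · rw [List.nodup_cons]
    exact ⟨last_notMem_map_up l, h.map up.injective⟩
  · simp [up_ne_last, hx]

lemma commute_O_up {n : ℕ} (l : List (Fin n)) (x : Fin n) :
    Commute (O (Fin.last n)) (gate (l.map up) (up x)) :=
  commute_O (last_notMem_map_up l) (last_ne_up x)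

lemma commute_Z_up {n : ℕ} (l : List (Fin n)) (x : Fin n) :
    Commute (Z (Fin.last n)) (gate (l.map up) (up x)) :=
  commute_Z (last_notMem_map_up l) (last_ne_up x)

lemma tof_sq {n : ℕ} (a b x : Fin n) : gate [a, b] x * gate [a, b] x = 1 := by
  by_cases h : [a, b, x].Nodup
  · have h0 : op Circ.tof * op Circ.tof = 1 := Quotient.sound Circ.Eqv.tof10
    rw [op_tof] at h0
    have := congrArg (place (emb [a, b, x] h)) h0
    simp only [map_mul, place_gate, map_one] at this
    exact this
  · rw [gate_of_not, one_mul]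
    simp at h ⊢; grind

lemma sq_pad {n : ℕ} {x : Fin n} {l : List (Fin n)} (hl : l.length ≤ 1)
    (h : gate (Fin.last n :: l.map up) (up x) * gate (Fin.last n :: l.map up) (up x) = 1) :
    gate l x * gate l x = 1 := by
  by_cases hn : l.Nodup ∧ x ∉ l
  · apply cancel_O
    have hp := up_pad hl hn.1 hn.2
    rw [map_mul, map_one, place_gate, ← mul_assoc, (commute_O_up l x).eq,
      mul_assoc, ← hp, ← mul_assoc, ← (commute_O_up l x).eq, ← hp, mul_assoc, h]
  · rw [gate_of_not hn, one_mul]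

lemma cnot_sq {n : ℕ} (a x : Fin n) : gate [a] x * gate [a] x = 1 :=
  sq_pad le_rfl (tof_sq _ _ _)

lemma not_sq {n : ℕ} (x : Fin n) : gate [] x * gate [] x = 1 :=
  sq_pad (Nat.zero_le _) (cnot_sq _ _)

/-- The two `not` gates in the definitions of `ket0` and `bra0` meet and cancel, so `not_sq` must
precede every use of `cancel_Z`. -/
lemma ket0_bra0 : mk Circ.ket0 ≫ mk Circ.bra0 = 𝟙 (of 0) := by
  have h := not_sq (0 : Fin 1)
  rw [← op_not] at h
  have h1 : mk Circ.ket0 = mk Circ.ket1 ≫ op Circ.not := rfl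
  have h2 : mk Circ.bra0 = op Circ.not ≫ mk Circ.bra1 := rfl
  rw [h1, h2, Category.assoc, ← Category.assoc (op Circ.not), ← Op.mul_def, h, Op.one_def,
    Category.id_comp, ket1_bra1]

lemma cancel_Z {n : ℕ} {f g : Op n}
    (h : Z (Fin.last n) * place up f = Z (Fin.last n) * place up g) : f = g :=
  place_cancel ket0_bra0 _ h

lemma Z_mul_Z {n : ℕ} (z : Fin n) : Z z * Z z = Z z := by
  rw [Z, ← map_mul, Op.mul_def, Category.assoc, ← Category.assoc (mk Circ.ket0), ket0_bra0,
    Category.id_comp]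

lemma Z_mul_tof {n : ℕ} (a b x : Fin n) : Z a * gate [a, b] x = Z a := by
  by_cases h : [a, b, x].Nodup
  · have h1 : Z (0 : Fin 3) = tensorMap (mk Circ.bra0 ≫ mk Circ.ket0) (𝟙 (of 2)) :=
      place_single_zero (k := 2) _
    have h2 : tensorMap (mk Circ.ket0) (𝟙 (of 2)) ≫ op Circ.tof =
      tensorMap (mk Circ.ket0) (𝟙 (of 2)) := Quotient.sound Circ.Eqv.tof2
    have h0 : Z (0 : Fin 3) * gate [0, 1] 2 = Z 0 := by
      rw [h1, ← op_tof, Op.mul_def, tensorMap_id_comp, Category.assoc]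
      exact congrArg _ h2
    have := congrArg (place (emb [a, b, x] h)) h0
    simp only [map_mul, place_gate, place_Z] at this
    exact this
  · rw [gate_of_not, mul_one]
    simp at h ⊢; grind

lemma tof_mul_Z {n : ℕ} (a b x : Fin n) : gate [a, b] x * Z a = Z a := by
  by_cases h : [a, b, x].Nodup
  · have h1 : Z (0 : Fin 3) = tensorMap (mk Circ.bra0 ≫ mk Circ.ket0) (𝟙 (of 2)) :=
      place_single_zero (k := 2) _
    have h2 : op Circ.tof ≫ tensorMap (mk Circ.bra0) (𝟙 (of 2)) =
      tensorMap (mk Circ.bra0) (𝟙 (of 2)) := Quotient.sound Circ.Eqv.tof2'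
    have h0 : gate [0, 1] 2 * Z (0 : Fin 3) = Z 0 := by
      rw [h1, ← op_tof, Op.mul_def, tensorMap_id_comp]
      exact (Category.assoc _ _ _).symm.trans (congrArg (· ≫ _) h2)
    have := congrArg (place (emb [a, b, x] h)) h0
    simp only [map_mul, place_gate, place_Z] at this
    exact this
  · rw [gate_of_not, one_mul]
    simp at h ⊢; grind

lemma Z_mul_cnot {n : ℕ} (a x : Fin n) : Z a * gate [a] x = Z a := by
  by_cases h : a = x
  · rw [gate_of_not, mul_one]
    simp [h]
  · apply cancel_O
    have hp := up_pad (l := [a]) (x := x) le_rfl (by simp) (by simpa using Ne.symm h)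
    have hc := (commute_O_Z (last_ne_up a)).eq
    rw [map_mul, place_gate, place_Z, ← mul_assoc, hc, mul_assoc, ← hp, ← mul_assoc, ← hc]
    rw [mul_assoc, List.map_cons, List.map_nil, tof_swap, Z_mul_tof]

lemma cnot_mul_Z {n : ℕ} (a x : Fin n) : gate [a] x * Z a = Z a := by
  by_cases h : a = x
  · rw [gate_of_not, one_mul]
    simp [h]
  · apply cancel_O
    have hp := up_pad (l := [a]) (x := x) le_rfl (by simp) (by simpa using Ne.symm h)
    rw [map_mul, place_gate, place_Z, ← mul_assoc, ← hp, mul_assoc, List.map_cons, List.map_nil,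
      tof_swap, tof_mul_Z]

/-- If a controlled not leaves its target in state 0, then its control was in state 0. The source is
the crossing written as three controlled nots: it expresses one controlled not through the crossing
and two reversed ones, which `Z` absorbs. -/
lemma Z_cnot_Z {n : ℕ} {a w : Fin n} (h : a ≠ w) : Z w * gate [a] w * Z w = Z w * Z a := by
  have h0 : Z (0 : Fin 2) * gate [1] 0 * Z 0 = Z 0 * Z 1 := by
    set S : Op 2 := pm (Equiv.swap (0 : Fin 2) 1) with hS
    have hS1 : gate [(0 : Fin 2)] 1 * gate [1] 0 * gate [0] 1 = S := by
      rw [← op_cnotOn (a := (0 : Fin 2)) (c := 1) (by decide),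
        ← op_cnotOn (a := (1 : Fin 2)) (c := 0) (by decide)]
      exact Quotient.sound Circ.Eqv.tof15
    have hSS : S * S = 1 := by
      rw [hS, Op.mul_def, pm_comp]
      have : (Equiv.swap (0 : Fin 2) 1).trans (Equiv.swap 0 1) = Equiv.refl _ := by decide
      rw [this]; rfl
    have hZ : S * Z 0 = Z 1 * S := by
      have h1 := place_toEmbedding (Equiv.swap (0 : Fin 2) 1) (Z 0)
      rw [Equiv.symm_swap, place_Z] at h1
      have h2 : Z (1 : Fin 2) = S * (Z 0 * S) := h1
      rw [h2, mul_assoc, mul_assoc, hSS, mul_one]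
    have hC : gate [(1 : Fin 2)] 0 = gate [0] 1 * S * gate [0] 1 := by
      rw [← hS1]
      simp only [mul_assoc, cnot_sq, mul_one]
      rw [← mul_assoc, cnot_sq, one_mul]
    calc Z (0 : Fin 2) * gate [1] 0 * Z 0 = Z 0 * gate [0] 1 * S * (gate [0] 1 * Z 0) := by
          rw [hC]; simp only [mul_assoc]
      _ = Z 0 * Z 1 * S := by rw [Z_mul_cnot, cnot_mul_Z, mul_assoc, hZ, mul_assoc]
      -- The crossing is expanded again; each of its three factors is absorbed by the projection on
      -- its own control.
      _ = Z 1 * (Z 0 * gate [0] 1) * (gate [1] 0 * gate [0] 1) := by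
          rw [← hS1, (commute_Z_Z 0 1).eq]; simp only [mul_assoc]
      _ = Z 0 * (Z 1 * gate [1] 0) * gate [0] 1 := by
          rw [Z_mul_cnot, (commute_Z_Z 1 0).eq]; simp only [mul_assoc]
      _ = Z 1 * (Z 0 * gate [0] 1) := by
          rw [Z_mul_cnot, (commute_Z_Z 0 1).eq, mul_assoc]
      _ = Z 0 * Z 1 := by rw [Z_mul_cnot, (commute_Z_Z 1 0).eq]
  have := congrArg (place (emb [w, a] (by simpa using h.symm))) h0
  simp only [map_mul, place_gate, place_Z] at this
  exact this

/-! ### Relations between Toffoli gates on arbitrary wires. -/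

lemma place_commute_gates {m n : ℕ} (e : Fin m ↪ Fin n) {l l' : List (Fin m)} {x y : Fin m}
    (h : Commute (gate l x) (gate l' y)) :
    Commute (gate (l.map e) (e x)) (gate (l'.map e) (e y)) := by
  rw [← place_gate, ← place_gate]
  exact h.map _

lemma tof_commute_same₀ {n : ℕ} {a b x c d : Fin n} (h : [a, b, x, c, d].Nodup) :
    Commute (gate [a, b] x) (gate [d, c] x) := by
  have h0 : Commute (gate [(0 : Fin 5), 1] 2) (gate [4, 3] 2) := by
    rw [← op_tofOn (by decide), ← op_tofOn (by decide)]
    exact Quotient.sound Circ.Eqv.tof3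
  exact place_commute_gates (emb _ h) h0

lemma tof_commute_same₁ {n : ℕ} {a b c x : Fin n} (h : [a, b, c, x].Nodup) :
    Commute (gate [a, c] x) (gate [b, c] x) := by
  have h0 : Commute (gate [(0 : Fin 4), 2] 3) (gate [1, 2] 3) := by
    rw [← op_tofOn (by decide), ← op_tofOn (by decide)]
    exact Quotient.sound Circ.Eqv.tof6
  exact place_commute_gates (emb _ h) h0

lemma tof_commute_ne₁ {n : ℕ} {x a c b y : Fin n} (h : [x, a, c, b, y].Nodup) :
    Commute (gate [c, a] x) (gate [c, b] y) := by
  have h0 : Commute (gate [(2 : Fin 5), 1] 0) (gate [2, 3] 4) := by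
    rw [← op_tofOn (by decide), ← op_tofOn (by decide)]
    exact Quotient.sound Circ.Eqv.tof4
  exact place_commute_gates (emb _ h) h0

lemma tof_commute_ne₂ {n : ℕ} {x a b y : Fin n} (h : [x, a, b, y].Nodup) :
    Commute (gate [b, a] x) (gate [a, b] y) := by
  have h0 : Commute (gate [(2 : Fin 4), 1] 0) (gate [1, 2] 3) := by
    rw [← op_tofOn (by decide), ← op_tofOn (by decide)]
    exact Quotient.sound Circ.Eqv.tof5
  exact place_commute_gates (emb _ h) h0

lemma gate_commute_of_disjoint {n : ℕ} {l l' : List (Fin n)} {x y : Fin n}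
    (h : ∀ i ∈ l ++ [x], ∀ j ∈ l' ++ [y], i ≠ j) : Commute (gate l x) (gate l' y) := by
  have key : ∀ (l : List (Fin n)) (x : Fin n) i,
      Fin.snoc (α := fun _ => Fin n) l.get x i ∈ l ++ [x] := fun l x i => by
    induction i using Fin.lastCases with
    | last => simp
    | cast i => rw [Fin.snoc_castSucc]; simp
  rw [gate, gate]
  split_ifs with h1 h2
  · exact place_commute _ _ (fun i j => h _ (key _ _ i) _ (key _ _ j)) _ _
  all_goals simp

lemma tof_commute {n : ℕ} {a b c d x y : Fin n} (hx : x ∉ [c, d]) (hy : y ∉ [a, b]) :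
    Commute (gate [a, b] x) (gate [c, d] y) := by
  by_cases h1 : [a, b].Nodup ∧ x ∉ [a, b]
  swap
  · rw [gate_of_not h1]; exact Commute.one_left _
  by_cases h2 : [c, d].Nodup ∧ y ∉ [c, d]
  swap
  · rw [gate_of_not h2]; exact Commute.one_right _
  simp only [List.nodup_cons, List.mem_cons, List.not_mem_nil, or_false, not_or,
    List.nodup_nil, not_false_eq_true, and_true] at h1 h2 hx hy
  obtain ⟨hab, hxa, hxb⟩ := h1
  obtain ⟨hcd, hyc, hyd⟩ := h2
  obtain ⟨hxc, hxd⟩ := hx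
  obtain ⟨hya, hyb⟩ := hy
  -- Exactly one common control `c`; the targets may coincide.
  have one : ∀ {c a b : Fin n}, a ≠ c → b ≠ c → a ≠ b → x ≠ a → x ≠ b → x ≠ c → y ≠ a → y ≠ b →
      y ≠ c → Commute (gate [a, c] x) (gate [b, c] y) := by
    intro c a b _ _ _ _ _ _ _ _ _
    by_cases hxy : x = y
    · subst hxy
      exact tof_commute_same₁ (by simp; grind)
    · rw [tof_swap a c, tof_swap b c]
      exact tof_commute_ne₁ (by simp; grind)
  -- The same two controls.
  have two : ∀ {a b : Fin n}, a ≠ b → x ≠ a → x ≠ b → y ≠ a → y ≠ b →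
      Commute (gate [a, b] x) (gate [a, b] y) := by
    intro a b _ _ _ _ _
    by_cases hxy : x = y
    · subst hxy
      exact Commute.refl _
    · rw [tof_swap a b x]
      exact tof_commute_ne₂ (by simp; grind)
  by_cases hac : a = c
  · subst hac
    by_cases hbd : b = d
    · subst hbd
      exact two hab hxa hxb hya hyb
    · rw [tof_swap a b, tof_swap a d]
      exact one (Ne.symm hab) (Ne.symm hcd) hbd hxb hxd hxa hyb hyd hya
  by_cases had : a = d
  · subst had
    rw [tof_swap c a]
    by_cases hbc : b = c
    · subst hbc
      exact two hab hxa hxb hya hyb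
    · rw [tof_swap a b, tof_swap a c]
      exact one (Ne.symm hab) hcd hbc hxb hxc hxa hyb hyc hya
  by_cases hbc : b = c
  · subst hbc
    rw [tof_swap b d]
    exact one hab (Ne.symm hcd) had hxa hxd hxb hya hyd hyb
  by_cases hbd : b = d
  · subst hbd
    exact one hab hcd hac hxa hxc hxb hya hyc hyb
  by_cases hxy : x = y
  · subst hxy
    exact tof_commute_same₀ (by simp; grind)
  · refine gate_commute_of_disjoint fun i hi j hj => ?_
    simp at hi hj
    grind

lemma tof_cnot_tof {n : ℕ} {a b c x : Fin n} (h : [a, b, c, x].Nodup) :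
    gate [a, b] c * gate [c] x * gate [a, b] c = gate [a, b] x * gate [c] x := by
  have h0 : gate [(0 : Fin 4), 1] 2 * gate [2] 3 * gate [0, 1] 2 =
      gate [0, 1] 3 * gate [2] 3 := by
    rw [← op_tofOn (by decide), ← op_tofOn (by decide), ← op_cnotOn (by decide)]
    exact Quotient.sound Circ.Eqv.tof14
  have := congrArg (place (emb _ h)) h0
  simp only [map_mul, place_gate] at this
  exact this

lemma tof_tof_tof {n : ℕ} {a b c x : Fin n} (h : [a, b, c, x].Nodup) :
    gate [a, b] c * gate [b, c] x * gate [a, b] c = gate [a, b] x * gate [b, c] x := by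
  have h0 : gate [(0 : Fin 4), 1] 2 * gate [1, 2] 3 * gate [0, 1] 2 =
      gate [0, 1] 3 * gate [1, 2] 3 := by
    rw [← op_tofOn (by decide), ← op_tofOn (by decide), ← op_tofOn (by decide)]
    exact Quotient.sound Circ.Eqv.tof13
  have := congrArg (place (emb _ h)) h0
  simp only [map_mul, place_gate] at this
  exact this

lemma cnot_tof_cnot {n : ℕ} {a b c x : Fin n} (h : [a, b, c, x].Nodup) :
    gate [a] b * gate [b, c] x * gate [a] b = gate [a, c] x * gate [b, c] x := by
  have h0 : gate [(0 : Fin 4)] 1 * gate [1, 2] 3 * gate [0] 1 =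
      gate [0, 2] 3 * gate [1, 2] 3 := by
    rw [← op_tofOn (by decide), ← op_tofOn (by decide), ← op_cnotOn (by decide)]
    exact Quotient.sound Circ.Eqv.tof12
  have := congrArg (place (emb _ h)) h0
  simp only [map_mul, place_gate] at this
  exact this

/-! ### The recursion, and commutation of arbitrary gates. -/

lemma Z_mul_cnotN (k : ℕ) :
    Z (2 : Fin (k + 5)) * place (Fin.succAboveEmb 2) (op (Circ.cnotN (k + 3))) =
      Z 2 * (place (Fin.castLEEmb (Nat.le_add_left 3 (k + 2))) (op Circ.tof) *
        place (Fin.addNatEmb 2) (op (Circ.cnotN (k + 2))) *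
        place (Fin.castLEEmb (Nat.le_add_left 3 (k + 2))) (op Circ.tof)) * Z 2 := by
  have h : op (Circ.cnotN (k + 3)) = ins (mk Circ.ket0) (2 : Fin (k + 5)) ≫
      (place (Fin.castLEEmb (Nat.le_add_left 3 (k + 2))) (op Circ.tof) *
        place (Fin.addNatEmb 2) (op (Circ.cnotN (k + 2))) *
        place (Fin.castLEEmb (Nat.le_add_left 3 (k + 2))) (op Circ.tof)) ≫
      rem (mk Circ.bra0) (2 : Fin (k + 5)) := by
    simp only [Op.mul_def]
    simp only [← Category.assoc]
    rfl
  rw [h]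
  exact place_compress _ _ _ _

lemma snoc_get_apply {n : ℕ} (l : List (Fin n)) (x : Fin n) (i : Fin (l.length + 1)) :
    Fin.snoc (α := fun _ => Fin n) l.get x i = (l ++ [x])[i.val]'(by simp; omega) := by
  induction i using Fin.lastCases with
  | last => simp
  | cast i => rw [Fin.snoc_castSucc]; simp

lemma Z_gate_Z {n : ℕ} {a b c x z : Fin n} {l : List (Fin n)} (h : (a :: b :: c :: l).Nodup)
    (hx : x ∉ a :: b :: c :: l) (hz : z ∉ a :: b :: c :: l) (hzx : z ≠ x) :
    Z z * gate (a :: b :: c :: l) x =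
      Z z * (gate [a, b] z * gate (z :: c :: l) x * gate [a, b] z) * Z z := by
  have hn : (a :: b :: z :: c :: l).Nodup ∧ x ∉ a :: b :: z :: c :: l := by
    simp at h hx hz ⊢; grind
  -- The wires in the order of the defining circuit, where the ancilla `z` has position 2.
  let w : Fin (l.length + 5) ↪ Fin n := ⟨_, snoc_get_injective_iff.2 hn⟩
  have hw : ∀ i, w i = (a :: b :: z :: c :: l ++ [x])[i.val]'(by simp; omega) :=
    fun i => snoc_get_apply (a :: b :: z :: c :: l) x i
  have h1 : gate (a :: b :: c :: l) x =
      place ((Fin.succAboveEmb 2).trans w) (op (Circ.cnotN (l.length + 3))) := by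
    have hval : ∀ i : Fin (l.length + 4), ((Fin.succAbove (2 : Fin (l.length + 5)) i : Fin _) : ℕ) =
        if i.val < 2 then i.val else i.val + 1 := fun i => by
      rw [Fin.succAbove]
      simp only [Fin.lt_def, Fin.val_castSucc]
      have : ((2 : Fin (l.length + 5)) : ℕ) = 2 := rfl
      rw [this]
      split_ifs <;> rfl
    refine gate_eq_place _ _ _ rfl (fun i => ?_) ?_
    · simp only [Function.Embedding.trans_apply, hw, Fin.coe_succAboveEmb, hval, Fin.val_castSucc]
      obtain ⟨i, hi⟩ := i
      match i with
      | 0 => rfl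
      | 1 => rfl
      | i + 2 =>
        simp at hi
        simp
        grind
    · simp [hw, hval]
  have h2 : gate [a, b] z =
      place ((Fin.castLEEmb (Nat.le_add_left 3 (l.length + 2))).trans w) (op Circ.tof) := by
    refine gate_eq_place (k := 2) _ _ _ rfl (fun i => ?_) ?_
    · fin_cases i <;> simp [hw]
    · simp [hw]
  have h3 : gate (z :: c :: l) x =
      place ((Fin.addNatEmb 2).trans w) (op (Circ.cnotN (l.length + 2))) := by
    refine gate_eq_place _ _ _ rfl (fun i => ?_) ?_
    · simp only [Function.Embedding.trans_apply, hw, Fin.addNatEmb_apply, Fin.val_addNat,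
        Fin.val_castSucc]
      obtain ⟨i, hi⟩ := i
      match i with
      | 0 => rfl
      | 1 => rfl
      | i + 2 =>
        simp at hi
        simp [List.getElem_append]
        grind
    · simp [hw]
  have h4 : w 2 = z := by rw [hw]; rfl
  have := congrArg (place w) (Z_mul_cnotN l.length)
  simp only [map_mul, place_place, place_Z, h4] at this
  rw [h1, h2, h3, this]

/-- Gates with `k` and `k'` controls commute if neither target is a control of the other one. -/
def CommuteAt (k k' : ℕ) : Prop :=
  ∀ (n : ℕ) (l l' : List (Fin n)) (x y : Fin n), l.length = k → l'.length = k' → x ∉ l' → y ∉ l →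
    Commute (gate l x) (gate l' y)

lemma CommuteAt.symm {k k' : ℕ} (h : CommuteAt k k') : CommuteAt k' k :=
  fun n l l' x y hl hl' hx hy => (h n l' l y x hl' hl hy hx).symm

lemma commute_of_cancel {M : Type*} [Monoid M] {p f f' g : M} (hp : p * f = p * f')
    (hg : Commute p g) (hfg : Commute f' g) : p * (f * g) = p * (g * f) := by
  calc p * (f * g) = p * f' * g := by rw [← mul_assoc, hp]
    _ = p * g * f' := by rw [mul_assoc, hfg.eq, mul_assoc]
    _ = g * (p * f) := by rw [hg.eq, mul_assoc, hp]
    _ = p * (g * f) := by rw [← mul_assoc, ← mul_assoc, hg.eq]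

/-- Descends from `k + 1` controls to `k` by a fresh control in state 1. -/
lemma CommuteAt.pad {k k' : ℕ} (hk : k ≤ 1) (h : CommuteAt (k + 1) k') : CommuteAt k k' := by
  intro n l l' x y hl hl' hx hy
  by_cases hn : l.Nodup ∧ x ∉ l
  swap
  · rw [gate_of_not hn]; exact Commute.one_left _
  apply cancel_O
  simp only [map_mul, place_gate]
  refine commute_of_cancel (up_pad (hl.trans_le hk) hn.1 hn.2).symm (commute_O_up _ _) (h _ _ _ _ _ (by simp [hl]) (by simpa using hl') (by simpa using hx) ?_)
  simp [up_ne_last, hy]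

/-- Expands the longer gate by the recursion. The trailing projection of `Z_gate_Z` does no harm
here: it lies on the fresh wire, hence commutes with the other gate. -/
lemma CommuteAt.ext {k k' : ℕ} (hk : 2 ≤ k) (h2 : CommuteAt 2 k') (h : CommuteAt k k') :
    CommuteAt (k + 1) k' := by
  intro n l l' x y hl hl' hx hy
  by_cases hn : l.Nodup ∧ x ∉ l
  swap
  · rw [gate_of_not hn]; exact Commute.one_left _
  match l, hl, hn with
  | a :: b :: c :: l, hl, hn =>
    apply cancel_Z
    simp only [map_mul, place_gate]
    have hz := last_notMem_map_up (a :: b :: c :: l)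
    have hrec := Z_gate_Z (hn.1.map up.injective) (x := up x) (by simpa using hn.2) hz
      (last_ne_up x)
    have cZ := commute_Z_up l' y
    have c1 : Commute (gate [up a, up b] (Fin.last n)) (gate (l'.map up) (up y)) := by
      refine h2 _ _ _ _ _ rfl (by simpa using hl') (last_notMem_map_up _) ?_
      simp at hy ⊢
      grind
    have c2 : Commute (gate (Fin.last n :: (c :: l).map up) (up x)) (gate (l'.map up) (up y)) := by
      refine h _ _ _ _ _ (by simpa using hl) (by simpa using hl') (by simpa using hx) ?_
      simp [up_ne_last] at hy ⊢
      grind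
    refine commute_of_cancel (f' := gate [up a, up b] (Fin.last n) *
        gate (Fin.last n :: (c :: l).map up) (up x) * gate [up a, up b] (Fin.last n) *
          Z (Fin.last n)) ?_ cZ
        (((c1.mul_left c2).mul_left c1).mul_left cZ)
    rw [← mul_assoc]
    exact hrec
  | [_, _], hl, _ | [_], hl, _ | [], hl, _ => simp at hl; try omega

lemma commuteAt (k k' : ℕ) : CommuteAt k k' := by
  have h22 : CommuteAt 2 2 := by
    intro n l l' x y hl hl' hx hy
    obtain ⟨a, b, rfl⟩ := List.length_eq_two.1 hl
    obtain ⟨c, d, rfl⟩ := List.length_eq_two.1 hl'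
    exact tof_commute hx hy
  have extend : ∀ k', CommuteAt 2 k' → ∀ k, CommuteAt k k' := fun k' h k => by
    have h1 := CommuteAt.pad le_rfl h
    by_cases hk : 2 ≤ k
    · induction k, hk using Nat.le_induction with
      | base => exact h
      | succ k hk ih => exact CommuteAt.ext hk h ih
    · interval_cases k
      · exact CommuteAt.pad (Nat.zero_le _) h1
      · exact h1
  -- From two Toffoli gates, first one number of controls is made arbitrary, then by symmetry the
  -- other.
  exact extend k' (extend 2 h22 k').symm k

lemma gate_commute {n : ℕ} {l l' : List (Fin n)} {x y : Fin n} (hx : x ∉ l') (hy : y ∉ l) :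
    Commute (gate l x) (gate l' y) := commuteAt _ _ n l l' x y rfl rfl hx hy

/-! ### The recursion without its trailing projection. -/

/-- A circuit that commutes with copying `z` to a fresh wire preserves state 0 on `z`. By `Z_cnot_Z`
the trailing `Z z` is a controlled not onto the fresh wire, between two projections of that wire; it
moves left past `U` and is absorbed by the leading `Z z`. -/
lemma Z_mul_mul_Z {n : ℕ} {z : Fin n} {U : Op n}
    (h : Commute (place up U) (gate [up z] (Fin.last n)))
    (hZ : Commute (Z (Fin.last n)) (place up U)) : Z z * U * Z z = Z z * U := by
  apply cancel_Z
  simp only [map_mul, place_Z]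
  set w := Fin.last n
  set V := place up U
  have c := (commute_Z_Z (up z) w).eq
  calc Z w * (Z (up z) * V * Z (up z)) = Z (up z) * V * (Z w * Z (up z)) := by
        rw [← mul_assoc, ← mul_assoc, ← c, mul_assoc (Z (up z)), hZ.eq]
        simp only [mul_assoc, c]
    _ = Z (up z) * (V * Z w) * gate [up z] w * Z w := by
        rw [← Z_cnot_Z (up_ne_last z)]; simp only [mul_assoc]
        rfl
    _ = Z w * Z (up z) * (V * gate [up z] w) * Z w := by
        rw [← hZ.eq, ← mul_assoc (Z (up z)), c]
        simp only [mul_assoc]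
    _ = Z w * (Z (up z) * gate [up z] w) * V * Z w := by
        rw [h.eq]; simp only [mul_assoc]
    _ = Z w * Z (up z) * Z w * V := by
        rw [Z_mul_cnot]; simp only [mul_assoc, hZ.eq]
    _ = Z w * (Z (up z) * V) := by
        rw [mul_assoc (Z w), c, ← mul_assoc, Z_mul_Z]; simp only [mul_assoc]

/-- A gate with controls `a`, `b`, … is a gate with these two controls replaced by a new wire in
state `0`, between two Toffoli gates. -/
lemma Z_mul_gate {n : ℕ} {a b x z : Fin n} {l : List (Fin n)} (h : (a :: b :: l).Nodup)
    (hx : x ∉ a :: b :: l) (hz : z ∉ a :: b :: l) (hzx : z ≠ x) :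
    Z z * gate (a :: b :: l) x =
      Z z * (gate [a, b] z * gate (z :: l) x * gate [a, b] z) := by
  match l with
  -- Two controls are not covered by the recursive definition, since `cnotN 2` is `tof` itself.
  | [] =>
    rw [tof_cnot_tof (by simp at h hx hz ⊢; grind), ← mul_assoc,
      (commute_Z hz hzx).eq, mul_assoc, Z_mul_cnot]
  | c :: l =>
    rw [Z_gate_Z h hx hz hzx]
    have hzl : z ∉ c :: l := fun h => hz (by simp at h ⊢; grind)
    have hza : z ∉ [a, b] := fun h => hz (by simp at h ⊢; grind)
    refine Z_mul_mul_Z ?_ ?_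
    · simp only [map_mul, place_gate]
      set w := Fin.last n with hw
      have c1 : gate ([a, b].map up) (up z) * gate [up z] w * gate ([a, b].map up) (up z) =
          gate ([a, b].map up) w * gate [up z] w := by
        refine tof_cnot_tof ?_
        simp [hw, up_ne_last] at h hz ⊢
        grind
      have c2 : Commute (gate ((z :: c :: l).map up) (up x)) (gate [up z] w) :=
        gate_commute (by simpa using hzx.symm) (last_notMem_map_up _)
      have c3 : Commute (gate ((z :: c :: l).map up) (up x)) (gate ([a, b].map up) w) :=
        gate_commute (by simp at hx ⊢; grind) (last_notMem_map_up _)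
      have c4 : Commute (gate ([a, b].map up) (up z)) (gate ([a, b].map up) w) :=
        gate_commute (by simpa using hza) (last_notMem_map_up _)
      have sqw : gate ([a, b].map up) w * gate ([a, b].map up) w = 1 := tof_sq _ _ _
      have sqz : gate ([a, b].map up) (up z) * gate ([a, b].map up) (up z) = 1 := tof_sq _ _ _
      generalize gate ([a, b].map up) (up z) = T at *
      generalize gate ([a, b].map up) w = S at *
      generalize gate ((z :: c :: l).map up) (up x) = G at *
      generalize gate [up z] w = C at *
      have c5 : T * C = S * C * T := by rw [← c1, mul_assoc, sqz, mul_one]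
      have c6 : C * T = T * S * C := by
        rw [mul_assoc, ← c1]; simp only [← mul_assoc]; rw [sqz, one_mul]
      -- Passing `C` through the right-hand `T` leaves a Toffoli gate `S` onto `w`; this is what is
      -- needed to pass `C` through the left-hand `T`.
      calc T * G * T * C = T * G * S * (C * T) := by
            rw [mul_assoc _ T, c5]; simp only [mul_assoc]
        _ = T * S * (G * C) * T := by
            rw [mul_assoc T, c3.eq]; simp only [mul_assoc]
        _ = C * T * G * T := by rw [c2.eq, c6]; simp only [mul_assoc]
        _ = C * (T * G * T) := by simp only [mul_assoc]
    · simp only [map_mul, place_gate]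
      exact ((commute_Z_up _ _).mul_right (commute_Z_up _ _)).mul_right (commute_Z_up _ _)

/-! ### Symmetry in the controls. -/

lemma gate_swap₁₂ {n : ℕ} (a b c x : Fin n) : gate [a, b, c] x = gate [a, c, b] x := by
  by_cases h : [a, b, c, x].Nodup
  · have e1 : (Fin.castLEEmb (Nat.le_add_left 3 2) : Fin 3 ↪ Fin 5) =
        ⟨![(0 : Fin 5), 1, 2], by decide⟩ := by
      ext i; fin_cases i <;> rfl
    have e2 : (Fin.addNatEmb 2 : Fin 3 ↪ Fin 5) = ⟨![(2 : Fin 5), 3, 4], by decide⟩ := by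
      ext i; fin_cases i <;> rfl
    have e3 : op (Circ.cnotN 3) = op (Circ.comp (Circ.comp (Circ.comp (Circ.comp
        (Circ.insertAt Circ.ket0 2) (Circ.tofOn (0 : Fin 5) 1 2)) (Circ.tofOn 2 3 4))
          (Circ.tofOn 0 1 2)) (Circ.removeAt Circ.bra0 2)) := by
      rw [Circ.tofOn, Circ.tofOn, ← e1, ← e2]
      rfl
    have h0 : op (Circ.cnotN 3) = (pm (Equiv.swap (1 : Fin 4) 2) ≫ op (Circ.cnotN 3)) ≫
        pm (Equiv.swap (1 : Fin 4) 2) := by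
      rw [e3]
      exact Quotient.sound (Circ.Eqv.tof17.trans (Circ.Eqv.refl _))
    have h' := place_toEmbedding (Equiv.swap (1 : Fin 4) 2) (op (Circ.cnotN 3))
    rw [Equiv.symm_swap, ← Category.assoc, ← h0] at h'
    have g1 : gate [a, b, c] x = place (emb [a, b, c, x] h) (op (Circ.cnotN 3)) :=
      gate_eq_place (k := 3) _ _ _ rfl (fun i => by fin_cases i <;> rfl) rfl
    have g2 : gate [a, c, b] x = place ((Equiv.swap (1 : Fin 4) 2).toEmbedding.trans
        (emb [a, b, c, x] h)) (op (Circ.cnotN 3)) :=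
      gate_eq_place (k := 3) _ _ _ rfl (fun i => by fin_cases i <;> rfl) rfl
    rw [g1, g2, ← place_place, h']
  · rw [gate_of_not, gate_of_not] <;> · simp at h ⊢; grind

/-- Two steps of the recursion fold three controls at once onto `w`. This moves an exchange of the
second and third controls into a gate with only three controls, where it is `gate_swap₁₂`. -/
lemma Z_Z_gate {n : ℕ} {a b c x z w : Fin n} {l : List (Fin n)}
    (h : (w :: z :: a :: b :: c :: l).Nodup) (hx : x ∉ w :: z :: a :: b :: c :: l) :
    Z w * (Z z * gate (a :: b :: c :: l) x) =
      Z w * (Z z * (gate [a, b, c] w * gate (w :: l) x * gate [a, b, c] w)) := by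
  have h1 := Z_mul_gate (a := a) (b := b) (x := x) (z := z) (l := c :: l)
    (by simp at h ⊢; grind) (by simp at hx ⊢; grind) (by simp at h ⊢; grind)
    (by simp at hx ⊢; grind)
  have h2 := Z_mul_gate (a := z) (b := c) (x := x) (z := w) (l := l)
    (by simp at h ⊢; grind) (by simp at hx ⊢; grind) (by simp at h ⊢; grind)
    (by simp at hx ⊢; grind)
  have h3 := Z_mul_gate (a := a) (b := b) (x := w) (z := z) (l := [c])
    (by simp at h ⊢; grind) (by simp at h ⊢; grind) (by simp at h ⊢; grind)
    (by simp at h ⊢; grind)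
  have c1 : Commute (gate [a, b] z) (gate (w :: l) x) :=
    gate_commute (by simp at h ⊢; grind) (by simp at hx ⊢; grind)
  have cz1 : Commute (Z z) (gate (w :: l) x) :=
    commute_Z (by simp at h ⊢; grind) (by simp at hx ⊢; grind)
  have cz2 : Commute (Z z) (gate [a, b, c] w) :=
    commute_Z (by simp at h ⊢; grind) (by simp at h ⊢; grind)
  -- `T` acts on `z` only through `a` and `b`, so it does not meet `w`; it will cancel between the
  -- two copies of `gate [a, b, c] w`.
  have cw : Commute (Z w) (gate [a, b] z) :=
    commute_Z (by simp at h ⊢; grind) (by simp at h ⊢; grind)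
  have sq : gate [a, b] z * gate [a, b] z = 1 := tof_sq _ _ _
  have czw := commute_Z_Z w z
  generalize gate [a, b] z = T at *
  generalize gate (w :: l) x = G at *
  generalize gate [a, b, c] w = K at *
  generalize gate [z, c] w = S at *
  have e1 : Z z * (K * G * K) = Z z * (T * S * G * S * T) := by
    calc Z z * (K * G * K) = (K * G) * (Z z * K) := by
          rw [← mul_assoc, (cz2.mul_right cz1).eq, mul_assoc]
      _ = (K * G) * Z z * (T * S * T) := by rw [h3]; simp only [mul_assoc]
      _ = (Z z * K) * G * (T * S * T) := by
          rw [← (cz2.mul_right cz1).eq]; simp only [mul_assoc]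
      _ = Z z * (T * S * (T * G) * T * S * T) := by rw [h3]; simp only [mul_assoc]
      _ = Z z * (T * S * G * (T * T) * S * T) := by rw [c1.eq]; simp only [mul_assoc]
      _ = _ := by rw [sq, mul_one]
  calc _ = Z w * (Z z * (T * gate (z :: c :: l) x * T)) := by rw [h1]
    _ = Z z * T * (Z w * gate (z :: c :: l) x) * T := by
        rw [← mul_assoc, czw.eq]
        simp only [mul_assoc]
        rw [← mul_assoc (Z w), cw.eq]
        simp only [mul_assoc]
    _ = Z z * (T * Z w) * (S * G * S * T) := by rw [h2]; simp only [mul_assoc]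
    _ = Z w * (Z z * (T * S * G * S * T)) := by
        rw [← cw.eq, ← mul_assoc (Z z), ← czw.eq]; simp only [mul_assoc]
    _ = _ := by rw [e1]

lemma gate_swap {n : ℕ} (p : List (Fin n)) (a b : Fin n) (l : List (Fin n)) (x : Fin n) :
    gate (p ++ a :: b :: l) x = gate (p ++ b :: a :: l) x := by
  induction hk : p.length using Nat.strong_induction_on generalizing n with
  | _ k ih =>
  have hperm : (p ++ a :: b :: l).Perm (p ++ b :: a :: l) :=
    List.Perm.append_left p (List.Perm.swap b a l)
  by_cases hn : (p ++ a :: b :: l).Nodup ∧ x ∉ p ++ a :: b :: l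
  swap
  · rw [gate_of_not hn, gate_of_not]
    rwa [← hperm.nodup_iff, ← hperm.mem_iff]
  have hn' : (p ++ b :: a :: l).Nodup ∧ x ∉ p ++ b :: a :: l := by
    rwa [← hperm.nodup_iff, ← hperm.mem_iff]
  apply cancel_Z
  have m1 := hn.1.map up.injective
  have m2 := hn'.1.map up.injective
  have x1 : up x ∉ (p ++ a :: b :: l).map up := by simpa using hn.2
  have x2 : up x ∉ (p ++ b :: a :: l).map up := by simpa using hn'.2
  have z1 := last_notMem_map_up (p ++ a :: b :: l)
  have z2 := last_notMem_map_up (p ++ b :: a :: l)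
  match p, hk with
  | [], hk =>
    rw [place_gate, place_gate]
    exact (Z_mul_gate m1 x1 z1 (last_ne_up x)).trans
      (by rw [tof_swap]; exact (Z_mul_gate m2 x2 z2 (last_ne_up x)).symm)
  | [c], hk =>
    apply cancel_Z
    rw [place_gate, place_gate, map_mul, map_mul, place_Z, place_gate, place_gate]
    have key : ∀ a b : Fin n, (([c] ++ a :: b :: l).map up).Nodup →
        up x ∉ ([c] ++ a :: b :: l).map up →
        (Fin.last (n + 1) :: up (Fin.last n) :: (([c] ++ a :: b :: l).map up).map up).Nodup ∧
        up (up x) ∉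
          Fin.last (n + 1) :: up (Fin.last n) :: (([c] ++ a :: b :: l).map up).map up := by
      intro a b h1 h2
      refine ⟨List.nodup_cons.2 ⟨?_, List.nodup_cons.2 ⟨?_, h1.map up.injective⟩⟩, ?_⟩
      · simp [last_ne_up, up_ne_last]
      · simp [up_ne_last, last_ne_up]
      · rw [List.mem_cons, List.mem_cons, List.mem_map_of_injective up.injective]
        simpa only [up_ne_last, up.injective.eq_iff, false_or] using h2
    have k1 := key a b m1 x1
    have k2 := key b a m2 x2
    refine (Z_Z_gate k1.1 k1.2).trans ?_
    rw [gate_swap₁₂]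
    exact (Z_Z_gate k2.1 k2.2).symm
  -- The ancilla replaces `c` and `d`, so the prefix before the exchanged pair is shorter by one.
  | c :: d :: p, hk =>
    rw [place_gate, place_gate]
    refine (Z_mul_gate m1 x1 z1 (last_ne_up x)).trans ?_
    refine Eq.trans ?_ (Z_mul_gate m2 x2 z2 (last_ne_up x)).symm
    have := ih (p.length + 1) (by simp at hk; omega) (Fin.last n :: p.map up) (up a) (up b)
      (l.map up) (up x) (by simp)
    have h : gate (Fin.last n :: (p ++ a :: b :: l).map up) (up x) =
        gate (Fin.last n :: (p ++ b :: a :: l).map up) (up x) := by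
      simpa only [List.cons_append, List.map_append, List.map_cons] using this
    exact congrArg (fun G => Z (Fin.last n) * (gate [up c, up d] (Fin.last n) * G *
      gate [up c, up d] (Fin.last n))) h

lemma gate_perm {n : ℕ} {l l' : List (Fin n)} (h : l.Perm l') (x : Fin n) :
    gate l x = gate l' x := by
  -- The prefix `p` is what allows the induction to pass under a leading control.
  suffices ∀ p : List (Fin n), gate (p ++ l) x = gate (p ++ l') x from this []
  induction h with
  | nil => exact fun p => rfl
  | cons a _ ih => intro p; simpa using ih (p ++ [a])
  | swap a b l => exact fun p => gate_swap p b a l x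
  | trans _ _ ih₁ ih₂ => exact fun p => (ih₁ p).trans (ih₂ p)

/-! ### Gates indexed by sets: padding, involutivity, absorption. -/

/-- The not gate on `x` controlled by the wires in `X`; the identity if `x ∈ X`. -/
noncomputable def mc {n : ℕ} (X : Finset (Fin n)) (x : Fin n) : Op n := gate X.toList x

lemma gate_eq_mc {n : ℕ} {l : List (Fin n)} (hl : l.Nodup) (x : Fin n) :
    gate l x = mc l.toFinset x := gate_perm (List.toFinset_toList hl).symm x

lemma place_mc {n m : ℕ} (e : Fin n ↪ Fin m) (X : Finset (Fin n)) (x : Fin n) :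
    place e (mc X x) = mc (X.map e) (e x) := by
  rw [mc, place_gate, gate_eq_mc (X.nodup_toList.map e.injective)]
  congr 1
  ext i
  simp

lemma mcx_eq_mc {n : ℕ} (X : Finset (Fin n)) (x : Fin n) (hx : x ∉ X) : mcx X x hx = mc X x := by
  have h1 : gate (X.sort (· ≤ ·)) x = place (Circ.ctrlWires X x hx) (op (Circ.cnotN X.card)) := by
    refine gate_eq_place _ _ _ (by simp) (fun i => ?_) ?_
    · change Fin.snoc (α := fun _ => Fin n) (X.orderEmbOfFin rfl) x i.castSucc = _
      rw [Fin.snoc_castSucc, Finset.orderEmbOfFin_apply]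
      rfl
    · exact Fin.snoc_last (α := fun _ => Fin n) x (X.orderEmbOfFin rfl)
  exact h1.symm.trans (gate_perm (Finset.sort_perm_toList X (· ≤ ·)) x)

lemma mc_insert {n : ℕ} {X : Finset (Fin n)} {a : Fin n} (ha : a ∉ X) (x : Fin n) :
    mc (insert a X) x = gate (a :: X.toList) x := gate_perm (Finset.toList_insert ha) x

lemma mc_empty {n : ℕ} (x : Fin n) : mc ∅ x = gate [] x := by rw [mc, Finset.toList_empty]

lemma mc_singleton {n : ℕ} (a x : Fin n) : mc {a} x = gate [a] x := by
  rw [mc, Finset.toList_singleton]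

lemma mc_pair {n : ℕ} {a b : Fin n} (h : a ≠ b) (x : Fin n) : mc {a, b} x = gate [a, b] x := by
  rw [mc_insert (by simpa using h), Finset.toList_singleton]

lemma mc_commute {n : ℕ} {X Y : Finset (Fin n)} {x y : Fin n} (hx : x ∉ Y) (hy : y ∉ X) :
    Commute (mc X x) (mc Y y) := gate_commute (by simpa using hx) (by simpa using hy)

lemma commute_Z_mc {n : ℕ} {X : Finset (Fin n)} {x z : Fin n} (hz : z ∉ X) (hx : z ≠ x) :
    Commute (Z z) (mc X x) := commute_Z (by simpa using hz) hx

lemma commute_O_mc {n : ℕ} {X : Finset (Fin n)} {x z : Fin n} (hz : z ∉ X) (hx : z ≠ x) :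
    Commute (O z) (mc X x) := commute_O (by simpa using hz) hx

lemma Z_mul_mc {n : ℕ} {X : Finset (Fin n)} {a b x z : Fin n} (hab : a ≠ b) (ha : a ∉ X)
    (hb : b ∉ X) (hx : x ∉ insert a (insert b X)) (hz : z ∉ insert a (insert b X)) (hzx : z ≠ x) :
    Z z * mc (insert a (insert b X)) x =
      Z z * (mc {a, b} z * mc (insert z X) x * mc {a, b} z) := by
  have h1 : mc (insert a (insert b X)) x = gate (a :: b :: X.toList) x := by
    rw [mc_insert (by simp [hab, ha])]
    exact gate_perm ((Finset.toList_insert hb).cons a) x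
  simp only [Finset.mem_insert, not_or] at hx hz
  rw [h1, mc_pair hab, mc_insert hz.2.2]
  exact Z_mul_gate (by simp [hab, ha, hb, X.nodup_toList]) (by simpa using hx) (by simpa using hz)
    hzx

lemma exists_insert_insert {n : ℕ} {X : Finset (Fin n)} (h : 2 ≤ X.card) :
    ∃ a b Y, X = insert a (insert b Y) ∧ a ≠ b ∧ a ∉ Y ∧ b ∉ Y ∧ X.card = Y.card + 2 := by
  obtain ⟨k, hk⟩ := Nat.exists_eq_add_of_le h
  obtain ⟨a, X', ha, rfl, h1⟩ := Finset.card_eq_succ.1 (hk.trans (Nat.add_comm 2 k))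
  obtain ⟨b, Y, hb, rfl, h2⟩ := Finset.card_eq_succ.1 h1
  simp only [Finset.mem_insert, not_or] at ha
  exact ⟨a, b, Y, rfl, ha.1, ha.2, hb, by omega⟩

lemma last_notMem_up {n : ℕ} (X : Finset (Fin n)) : Fin.last n ∉ X.map up := by
  simp [up_ne_last]

lemma up_mem {n : ℕ} {X : Finset (Fin n)} {x : Fin n} : up x ∈ X.map up ↔ x ∈ X :=
  Finset.mem_map' up

lemma up_inj {n : ℕ} {x y : Fin n} : up x = up y ↔ x = y := up.injective.eq_iff

/-- With at least two controls besides `w`, two of them are folded onto an ancilla, and `O w` slides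
past the Toffoli gates to the smaller gate. -/
lemma O_mul_mc {n : ℕ} {X : Finset (Fin n)} {w x : Fin n} (hw : w ∉ X) (hwx : w ≠ x)
    (hx : x ∉ X) : O w * mc (insert w X) x = O w * mc X x := by
  induction hk : X.card using Nat.strong_induction_on generalizing n with
  | _ k ih =>
  by_cases h2 : 2 ≤ X.card
  · obtain ⟨a, b, Y, rfl, hab, ha, hb, hY⟩ := exists_insert_insert h2
    have := ih (Y.card + 1) (by omega) (X := insert (Fin.last n) (Y.map up)) (w := up w)
      (x := up x) (by simp [up_ne_last] at hw ⊢; tauto) (by rwa [Ne, up_inj])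
      (by simp [up_ne_last] at hx ⊢; tauto) (by simp [up_ne_last])
    apply cancel_Z
    simp only [map_mul, place_O, place_mc, Finset.map_insert]
    have e1 : insert (up w) (insert (up a) (insert (up b) (Y.map up))) =
        insert (up a) (insert (up b) (insert (up w) (Y.map up))) := by
      ext; simp; tauto
    have h1 := Z_mul_mc (X := Y.map up) (a := up a) (b := up b) (x := up x) (z := Fin.last n)
      (by rwa [Ne, up_inj]) (by rwa [up_mem]) (by rwa [up_mem])
      (by simpa [up_inj, up_mem] using hx) (by simp [last_ne_up, up_ne_last]) (last_ne_up x)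
    have h2 := Z_mul_mc (X := insert (up w) (Y.map up)) (a := up a) (b := up b) (x := up x)
      (z := Fin.last n) (by rwa [Ne, up_inj]) (by simp at hw ⊢; tauto)
      (by simp at hw ⊢; tauto)
      (by simp at hw hx ⊢; tauto) (by simp [last_ne_up, up_ne_last]) (last_ne_up x)
    have c0 := commute_O_Z (up_ne_last w)
    have c1 : Commute (O (up w)) (mc {up a, up b} (Fin.last n)) :=
      commute_O_mc (by simp at hw ⊢; tauto) (up_ne_last w)
    rw [e1]
    rw [Finset.insert_comm (Fin.last n)] at h2
    generalize mc {up a, up b} (Fin.last n) = T at *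
    generalize mc (insert (up a) (insert (up b) (insert (up w) (Y.map up)))) (up x) = K at *
    generalize mc (insert (up w) (insert (Fin.last n) (Y.map up))) (up x) = K' at *
    calc Z (Fin.last n) * (O (up w) * K) = O (up w) * (Z (Fin.last n) * K) := by
          rw [← mul_assoc, ← c0.eq, mul_assoc]
      _ = Z (Fin.last n) * (O (up w) * T) * K' * T := by
          rw [h2, ← mul_assoc, c0.eq]; simp only [mul_assoc]
      _ = Z (Fin.last n) * T * (O (up w) * K') * T := by rw [c1.eq]; simp only [mul_assoc]
      _ = Z (Fin.last n) * (T * O (up w)) * mc (insert (Fin.last n) (Y.map up)) (up x) * T := by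
          rw [this]; simp only [mul_assoc]
      _ = O (up w) * (Z (Fin.last n) * (T * mc (insert (Fin.last n) (Y.map up)) (up x) * T)) := by
          rw [← c1.eq, ← mul_assoc (Z _), ← c0.eq]; simp only [mul_assoc]
      _ = _ := by rw [← h1, ← mul_assoc, c0.eq, mul_assoc]
  · have hl : X.toList.length ≤ 1 := by rw [Finset.length_toList]; omega
    rw [mc_insert hw]
    exact O_mul_pad hl (by simp [hw, X.nodup_toList]) (by simp [hx, hwx.symm])

lemma mc_of_mem {n : ℕ} {X : Finset (Fin n)} {x : Fin n} (h : x ∈ X) : mc X x = 1 :=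
  gate_of_not (by simp [h])

/-- Beside the ancilla both copies are conjugates of a smaller gate by the same Toffoli gate, so the
inner Toffoli gates cancel. -/
lemma mc_sq {n : ℕ} (X : Finset (Fin n)) (x : Fin n) : mc X x * mc X x = 1 := by
  by_cases hx : x ∈ X
  · rw [mc_of_mem hx, one_mul]
  induction hk : X.card using Nat.strong_induction_on generalizing n with
  | _ k ih =>
  by_cases h2 : 2 ≤ X.card
  · obtain ⟨a, b, Y, rfl, hab, ha, hb, hY⟩ := exists_insert_insert h2
    by_cases hY0 : Y = ∅
    · subst hY0
      rw [insert_empty_eq, mc_pair hab, tof_sq]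
    have := ih (Y.card + 1) (by omega) (X := insert (Fin.last n) (Y.map up))
      (x := up x) (by simp [up_ne_last] at hx ⊢; tauto) (by simp [up_ne_last])
    apply cancel_Z
    simp only [map_mul, map_one, place_mc, Finset.map_insert]
    have h1 := Z_mul_mc (X := Y.map up) (a := up a) (b := up b) (x := up x) (z := Fin.last n)
      (by rwa [Ne, up_inj]) (by rwa [up_mem]) (by rwa [up_mem])
      (by simpa [up_inj, up_mem] using hx) (by simp [last_ne_up, up_ne_last]) (last_ne_up x)
    have c : Commute (Z (Fin.last n)) (mc (insert (up a) (insert (up b) (Y.map up))) (up x)) :=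
      commute_Z_mc (by simp [last_ne_up, up_ne_last]) (last_ne_up x)
    have sq : mc {up a, up b} (Fin.last n) * mc {up a, up b} (Fin.last n) = 1 := by
      rw [mc_pair (by rwa [Ne, up_inj]), tof_sq]
    generalize mc {up a, up b} (Fin.last n) = T at *
    generalize mc (insert (Fin.last n) (Y.map up)) (up x) = G at *
    generalize mc (insert (up a) (insert (up b) (Y.map up))) (up x) = K at *
    calc Z (Fin.last n) * (K * K) = K * (Z (Fin.last n) * K) :=
          c.left_comm K
      _ = K * Z (Fin.last n) * (T * G * T) := by rw [mul_assoc, ← h1]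
      _ = Z (Fin.last n) * K * (T * G * T) := by rw [c.eq]
      _ = Z (Fin.last n) * (T * G * (T * T) * G * T) := by rw [h1]; simp only [mul_assoc]
      _ = Z (Fin.last n) * (T * (G * G) * T) := by rw [sq]; simp only [mul_assoc, one_mul]
      _ = Z (Fin.last n) * 1 := by rw [this, mul_one, sq]
  · have hc : X.card = 0 ∨ X.card = 1 := by omega
    rcases hc with h | h
    · rw [Finset.card_eq_zero.1 h, mc_empty, not_sq]
    · obtain ⟨a, rfl⟩ := Finset.card_eq_one.1 h
      rw [mc_singleton, cnot_sq]

/-- The control `a` is one of the two folded onto the ancilla. Then `Z a` absorbs the Toffoli gates,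
and the ancilla, in state 0, absorbs the smaller gate by induction. -/
lemma Z_mul_mc_of_mem {n : ℕ} {X : Finset (Fin n)} {a : Fin n} (haX : a ∈ X) (x : Fin n) :
    Z a * mc X x = Z a := by
  by_cases hx : x ∈ X
  · rw [mc_of_mem hx, mul_one]
  induction hk : X.card using Nat.strong_induction_on generalizing n with
  | _ k ih =>
  obtain ⟨X, haX', rfl⟩ : ∃ Y, a ∉ Y ∧ X = insert a Y :=
    ⟨X.erase a, Finset.notMem_erase a X, (Finset.insert_erase haX).symm⟩
  rcases X.eq_empty_or_nonempty with rfl | ⟨b, hb⟩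
  · rw [insert_empty_eq, mc_singleton, Z_mul_cnot]
  obtain ⟨Y, hbY, rfl⟩ : ∃ Y, b ∉ Y ∧ X = insert b Y :=
    ⟨X.erase b, Finset.notMem_erase b X, (Finset.insert_erase hb).symm⟩
  simp only [Finset.mem_insert, not_or] at haX'
  have hab := haX'.1
  by_cases hY0 : Y = ∅
  · subst hY0
    rw [insert_empty_eq, mc_pair hab, Z_mul_tof]
  have h3 : (insert a (insert b Y)).card = Y.card + 2 := by
    rw [Finset.card_insert_of_notMem (by simp [haX']), Finset.card_insert_of_notMem hbY]
  have := ih (Y.card + 1) (by omega) (X := insert (Fin.last n) (Y.map up)) (a := Fin.last n)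
    (Finset.mem_insert_self _ _)
    (x := up x) (by simp [up_ne_last] at hx ⊢; tauto) (by simp [up_ne_last])
  apply cancel_Z
  simp only [map_mul, place_Z, place_mc, Finset.map_insert]
  have h1 := Z_mul_mc (X := Y.map up) (a := up a) (b := up b) (x := up x) (z := Fin.last n)
    (by rwa [Ne, up_inj]) (by rw [up_mem]; exact haX'.2) (by rwa [up_mem])
    (by simpa [up_inj, up_mem] using hx) (by simp [last_ne_up, up_ne_last]) (last_ne_up x)
  have hT : Z (up a) * mc {up a, up b} (Fin.last n) = Z (up a) := by
    rw [mc_pair (by rwa [Ne, up_inj]), Z_mul_tof]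
  have c := (commute_Z_Z (Fin.last n) (up a)).eq
  rw [← mul_assoc, c, mul_assoc, h1, ← mul_assoc, ← c, mul_assoc, ← mul_assoc (Z (up a)),
    ← mul_assoc (Z (up a)), hT, ← mul_assoc, ← mul_assoc, c, mul_assoc (Z (up a)), this,
    ← c, mul_assoc, hT]

/-! ### Conjugation by a controlled not or a Toffoli gate. -/

/-- The inductive step in abstract form: `A * G * A` is the gate with two controls folded onto an
ancilla, `C` the conjugating gate, `B` what `C` induces on the ancilla, and `K` the correction
produced by `B`. -/
lemma conj_conj {M : Type*} [Monoid M] {A B C G K : M} (hC : C * C = 1) (hA : C * A * C = B * A)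
    (hAB : Commute A B) (hCG : Commute C G) (hB : B * G * B = K * G) (hK : Commute A K) :
    C * (A * G * A) * C = K * (A * G * A) := by
  calc C * (A * G * A) * C = C * A * (C * C) * G * A * C := by
        rw [hC]; simp only [mul_assoc, mul_one]
    _ = (C * A * C) * (C * G) * A * C := by simp only [mul_assoc]
    _ = (C * A * C) * G * (C * A * C) := by rw [hCG.eq]; simp only [mul_assoc]
    _ = (A * B) * G * (B * A) := by rw [hA, hAB.eq]
    _ = A * (B * G * B) * A := by simp only [mul_assoc]
    _ = K * (A * G * A) := by rw [hB, ← mul_assoc, hK.eq]; simp only [mul_assoc]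

/-- This is `cnot_tof_cnot` with its extra control in state 1. -/
lemma cnot_cnot_cnot {n : ℕ} {z x y : Fin n} (h : [z, x, y].Nodup) :
    gate [z] x * gate [x] y * gate [z] x = gate [z] y * gate [x] y := by
  apply cancel_O
  simp only [map_mul, place_gate, List.map_cons, List.map_nil]
  set w := Fin.last n with hw
  have hn : z ≠ x ∧ z ≠ y ∧ x ≠ y := by simp at h; tauto
  have hz := last_ne_up z
  have hx := last_ne_up x
  have hy := last_ne_up y
  rw [← hw] at hz hx hy
  have h0 := cnot_tof_cnot (a := up z) (b := up x) (c := w) (x := up y)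
    (by simp [hn, hz.symm, hx.symm, hy])
  have p1 := O_mul_tof (a := w) (b := up x) (x := up y) (by simp [hn, hx, hy])
  have p2 := O_mul_tof (a := w) (b := up z) (x := up y) (by simp [hn, hz, hy])
  have c1 : Commute (O w) (gate [up z] (up x)) := commute_O (by simpa using hz) hx
  have c2 : Commute (O w) (gate [up z] (up y)) := commute_O (by simpa using hz) hy
  rw [tof_swap] at p1 p2
  calc O w * (gate [up z] (up x) * gate [up x] (up y) * gate [up z] (up x))
      = gate [up z] (up x) * (O w * gate [up x] (up y)) * gate [up z] (up x) := by
        rw [← mul_assoc, ← mul_assoc, c1.eq]; simp only [mul_assoc]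
    _ = O w * (gate [up z, w] (up y) * gate [up x, w] (up y)) := by
        rw [← p1, ← h0, ← mul_assoc, ← c1.eq]; simp only [mul_assoc]
    _ = gate [up z] (up y) * (O w * gate [up x, w] (up y)) := by
        rw [← mul_assoc, p2, c2.eq, mul_assoc]
    _ = O w * (gate [up z] (up y) * gate [up x] (up y)) := by
        rw [p1, ← mul_assoc, ← c2.eq, mul_assoc]

section Conjugation

variable {n : ℕ} {Y : Finset (Fin n)} {a b c x y z w : Fin n}

/-- Conjugation by a controlled not gate, with one more control of the conjugated gate. -/
lemma Z_mul_cnot_mc_cnot (hc : c ∉ Y) (hzx : z ≠ x) (hz : z ∉ insert c Y) (hx : x ∉ insert c Y)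
    (hy : y ∉ insert z (insert x (insert c Y))) (hw : w ∉ insert y (insert z (insert x (insert c Y))))
    (ih : mc {z, c} w * mc (insert w Y) y * mc {z, c} w =
      mc (insert z (insert c Y)) y * mc (insert w Y) y) :
    Z w * (mc {z} x * mc (insert x (insert c Y)) y * mc {z} x) =
      Z w * (mc (insert z (insert c Y)) y * mc (insert x (insert c Y)) y) := by
  simp only [Finset.mem_insert, not_or] at hz hx hy hw
  have h1 : Z w * mc (insert x (insert c Y)) y = _ := Z_mul_mc (by tauto) (by tauto) hc
    (by simp; tauto) (by simp; tauto) (by tauto)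
  -- The controls `x` and `c` are folded onto `w`, so conjugation by the controlled not induces
  -- conjugation by a Toffoli gate onto `w`.
  have h2 : mc {z} x * mc {x, c} w * mc {z} x = mc {z, c} w * mc {x, c} w := by
    rw [mc_singleton, mc_pair (by tauto), mc_pair (by tauto)]
    exact cnot_tof_cnot (by simp; grind)
  have key := conj_conj (by rw [mc_sq]) h2 (mc_commute (by simp; grind) (by simp; grind))
    (mc_commute (by simp; grind) (by simp; grind)) ih (mc_commute (by simp; grind) (by simp; grind))
  have c1 : Commute (Z w) (mc {z} x) := commute_Z_mc (by simp; grind) (by grind)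
  have c2 : Commute (Z w) (mc (insert z (insert c Y)) y) :=
    commute_Z_mc (by simp; grind) (by grind)
  rw [← mul_assoc, ← mul_assoc, c1.eq, mul_assoc (mc {z} x), h1, ← mul_assoc, ← c1.eq, mul_assoc,
    mul_assoc, ← mul_assoc (mc {z} x), key, ← mul_assoc, c2.eq, mul_assoc, ← h1, ← mul_assoc,
    ← c2.eq, mul_assoc]

/-- Conjugation by a Toffoli gate that shares a control with the conjugated gate. -/
lemma Z_mul_tof_mc_tof_of_shared (ha : a ∉ Y) (hab : a ≠ b) (hx : x ∉ insert b (insert a Y))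
    (hy : y ∉ insert b (insert x (insert a Y)))
    (hw : w ∉ insert y (insert b (insert x (insert a Y))))
    (ih : mc {a, b} w * mc (insert w Y) y * mc {a, b} w =
      mc (insert a (insert b Y)) y * mc (insert w Y) y) :
    Z w * (mc {a, b} x * mc (insert x (insert a Y)) y * mc {a, b} x) =
      Z w * (mc (insert a (insert b Y)) y * mc (insert x (insert a Y)) y) := by
  simp only [Finset.mem_insert, not_or] at hx hy hw
  have h1 : Z w * mc (insert x (insert a Y)) y = _ := Z_mul_mc (by tauto) (by tauto) ha
    (by simp; tauto) (by simp; tauto) (by tauto)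
  -- Folding `x` with the shared control `a` makes the Toffoli gate from `a, b` to `w` the induced
  -- one.
  have h2 : mc {a, b} x * mc {x, a} w * mc {a, b} x = mc {a, b} w * mc {x, a} w := by
    rw [mc_pair (by tauto), mc_pair (by tauto), mc_pair (by tauto), tof_swap a b x, tof_swap a b w,
      tof_swap x a]
    exact tof_tof_tof (by simp; grind)
  have key := conj_conj (by rw [mc_sq]) h2 (mc_commute (by simp; grind) (by simp; grind))
    (mc_commute (by simp; grind) (by simp; grind)) ih (mc_commute (by simp; grind) (by simp; grind))
  have c1 : Commute (Z w) (mc {a, b} x) := commute_Z_mc (by simp; grind) (by grind)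
  have c2 : Commute (Z w) (mc (insert a (insert b Y)) y) :=
    commute_Z_mc (by simp; grind) (by grind)
  rw [← mul_assoc, ← mul_assoc, c1.eq, mul_assoc (mc {a, b} x), h1, ← mul_assoc, ← c1.eq,
    mul_assoc, mul_assoc, ← mul_assoc (mc {a, b} x), key, ← mul_assoc, c2.eq, mul_assoc, ← h1,
    ← mul_assoc, ← c2.eq, mul_assoc]

/-- Conjugation by a Toffoli gate that shares no control with the conjugated gate. -/
lemma Z_mul_tof_mc_tof_of_disjoint (hab : a ≠ b) (ha : a ∉ Y) (hb : b ∉ Y)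
    (hx : x ∉ insert a (insert b Y)) (hy : y ∉ insert x (insert a (insert b Y)))
    (hz : z ∉ insert y (insert x (insert a (insert b Y))))
    (ih : mc {z} x * mc (insert x Y) y * mc {z} x = mc (insert z Y) y * mc (insert x Y) y) :
    Z z * (mc {a, b} x * mc (insert x Y) y * mc {a, b} x) =
      Z z * (mc (insert a (insert b Y)) y * mc (insert x Y) y) := by
  simp only [Finset.mem_insert, not_or] at hx hy hz
  have h1 : Z z * mc (insert a (insert b Y)) y = _ := Z_mul_mc hab ha hb
    (by simp; tauto) (by simp; tauto) (by tauto)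
  have h2 : mc {a, b} z * mc {z} x * mc {a, b} z = mc {a, b} x * mc {z} x := by
    rw [mc_singleton, mc_pair hab, mc_pair hab]
    exact tof_cnot_tof (by simp; grind)
  have h3 : Z z * mc (insert z Y) y = Z z := Z_mul_mc_of_mem (Finset.mem_insert_self _ _) y
  have sH := mc_sq (insert x Y) y
  have sC := mc_sq {z} x
  have sT := mc_sq {a, b} z
  have c1 : Commute (mc {a, b} z) (mc (insert x Y) y) :=
    mc_commute (by simp; grind) (by simp; grind)
  have c2 : Commute (mc {a, b} x) (mc {z} x) := mc_commute (by simp; grind) (by simp; grind)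
  have c3 : Commute (mc {a, b} x) (mc (insert z Y) y) :=
    mc_commute (by simp; grind) (by simp; grind)
  generalize mc {a, b} z = T at *
  generalize mc {a, b} x = S at *
  generalize mc {z} x = C at *
  generalize mc (insert x Y) y = H at *
  generalize mc (insert z Y) y = G at *
  have hG : G = C * H * C * H := by rw [ih, mul_assoc, sH, mul_one]
  rw [← mul_assoc (Z z) (mc _ _) H, h1]
  -- `Z z` creates the factor `G` for free, since `z` is a control of `G`. The product `G * H` is
  -- then a conjugate by the controlled not `C`, and `S * C` is in turn a conjugate of `C` by `T`.
  calc Z z * (S * H * S) = Z z * G * S * H * S := by rw [h3]; simp only [mul_assoc]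
    _ = Z z * (S * G) * H * S := by rw [c3.eq]; simp only [mul_assoc]
    _ = Z z * (S * (C * H * C) * (H * H) * S) := by rw [hG]; simp only [mul_assoc]
    _ = Z z * (S * C * H * (C * S)) := by rw [sH, mul_one]; simp only [mul_assoc]
    _ = Z z * (T * C * T * H * (T * C * T)) := by rw [← c2.eq, h2]
    _ = Z z * (T * C * (T * H) * T * C * T) := by simp only [mul_assoc]
    _ = Z z * (T * (C * H * (T * T) * C) * T) := by rw [c1.eq]; simp only [mul_assoc]
    _ = Z z * (T * (C * H * C) * T) := by rw [sT, mul_one]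
    _ = Z z * (T * G * (H * T)) := by rw [ih]; simp only [mul_assoc]
    _ = _ := by rw [← c1.eq]; simp only [mul_assoc]

end Conjugation

/-- Simultaneous induction on the size of `Y`. The controlled not case at `k + 1` uses the Toffoli
case at `k`. The Toffoli case at `k + 1` uses itself at `k` if a control is shared with `Y`, and
otherwise the controlled not case at `k + 1` on one more wire. -/
lemma mc_conj_aux (k : ℕ) : ∀ (n : ℕ) (Y : Finset (Fin n)), Y.card = k →
    (∀ z x y : Fin n, z ≠ x → z ∉ Y → x ∉ Y → y ∉ insert z (insert x Y) →
      mc {z} x * mc (insert x Y) y * mc {z} x = mc (insert z Y) y * mc (insert x Y) y) ∧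
    (∀ a b x y : Fin n, a ≠ b → x ∉ insert a (insert b Y) →
      y ∉ insert x (insert a (insert b Y)) →
      mc {a, b} x * mc (insert x Y) y * mc {a, b} x =
        mc (insert a (insert b Y)) y * mc (insert x Y) y) := by
  induction k with
  | zero =>
    intro n Y hY
    rw [Finset.card_eq_zero] at hY
    subst hY
    simp only [insert_empty_eq]
    constructor
    · intro z x y hzx _ _ hy
      simp only [mc_singleton]
      exact cnot_cnot_cnot (by simp at hy ⊢; grind)
    · intro a b x y hab hx hy
      simp only [mc_singleton, mc_pair hab]
      exact tof_cnot_tof (by simp at hx hy ⊢; grind)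
  | succ k ih =>
    have hV1 : ∀ (n : ℕ) (Y : Finset (Fin n)), Y.card = k + 1 → ∀ z x y : Fin n, z ≠ x → z ∉ Y →
        x ∉ Y → y ∉ insert z (insert x Y) →
        mc {z} x * mc (insert x Y) y * mc {z} x = mc (insert z Y) y * mc (insert x Y) y := by
      intro n Y hY z x y hzx hz hx hy
      obtain ⟨c, Y, hc, rfl, hY'⟩ := Finset.card_eq_succ.1 hY
      apply cancel_Z
      simp only [map_mul, place_mc, Finset.map_insert, Finset.map_singleton]
      refine Z_mul_cnot_mc_cnot (by rwa [up_mem]) (by rwa [Ne, up_inj])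
        (by simpa [up_inj, up_mem] using hz) (by simpa [up_inj, up_mem] using hx)
        (by simpa [up_inj, up_mem] using hy) (by simp [last_ne_up, up_ne_last]) ?_
      refine (ih (n + 1) (Y.map up) (by simpa using hY')).2 _ _ _ _ ?_ ?_ ?_
      · rw [Ne, up_inj]; rintro rfl; simp at hz
      · simp [last_ne_up, up_ne_last]
      · simp [up_ne_last] at hy ⊢; tauto
    intro n Y hY
    refine ⟨hV1 n Y hY, ?_⟩
    have shared : ∀ a b x y : Fin n, a ≠ b → a ∈ Y → x ∉ insert a (insert b Y) →
        y ∉ insert x (insert a (insert b Y)) →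
        mc {a, b} x * mc (insert x Y) y * mc {a, b} x =
          mc (insert a (insert b Y)) y * mc (insert x Y) y := by
      intro a b x y hab ha hx hy
      obtain ⟨Y, haY, rfl⟩ : ∃ Y', a ∉ Y' ∧ Y = insert a Y' :=
        ⟨Y.erase a, Finset.notMem_erase a Y, (Finset.insert_erase ha).symm⟩
      rw [Finset.card_insert_of_notMem haY, Nat.add_right_cancel_iff] at hY
      have e : insert a (insert b (insert a Y)) = insert a (insert b Y) := by
        ext; simp; tauto
      rw [e]
      apply cancel_Z
      simp only [map_mul, place_mc, Finset.map_insert, Finset.map_singleton]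
      refine Z_mul_tof_mc_tof_of_shared (by rwa [up_mem]) (by rwa [Ne, up_inj])
        (by simp at hx ⊢; tauto) (by simp at hy ⊢; tauto)
        (by simp [last_ne_up, up_ne_last]) ?_
      refine (ih (n + 1) (Y.map up) (by simpa using hY)).2 _ _ _ _ (by rwa [Ne, up_inj]) ?_ ?_
      · simp [last_ne_up, up_ne_last]
      · simp [up_ne_last] at hy ⊢; tauto
    intro a b x y hab hx hy
    by_cases ha : a ∈ Y
    · exact shared a b x y hab ha hx hy
    by_cases hb : b ∈ Y
    · rw [Finset.pair_comm, Finset.insert_comm a b]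
      rw [Finset.insert_comm a b] at hx hy
      exact shared b a x y hab.symm hb hx hy
    apply cancel_Z
    simp only [map_mul, place_mc, Finset.map_insert, Finset.map_singleton]
    refine Z_mul_tof_mc_tof_of_disjoint (by rwa [Ne, up_inj]) (by rwa [up_mem]) (by rwa [up_mem])
      (by simpa [up_inj, up_mem] using hx) (by simpa [up_inj, up_mem] using hy)
      (by simp [last_ne_up, up_ne_last]) ?_
    refine hV1 _ _ (by simpa using hY) _ _ _ (last_ne_up x) (last_notMem_up Y) ?_ ?_
    · simp at hx ⊢; tauto
    · simp [up_ne_last] at hy ⊢; tauto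

lemma tof_mc_tof {n : ℕ} {Y : Finset (Fin n)} {a b x y : Fin n} (hab : a ≠ b)
    (hx : x ∉ insert a (insert b Y)) (hy : y ∉ insert x (insert a (insert b Y))) :
    mc {a, b} x * mc (insert x Y) y * mc {a, b} x =
      mc (insert a (insert b Y)) y * mc (insert x Y) y :=
  (mc_conj_aux _ n Y rfl).2 a b x y hab hx hy

lemma cnot_mc_cnot {n : ℕ} {Y : Finset (Fin n)} {z x y : Fin n} (hzx : z ≠ x)
    (hz : z ∉ Y) (hx : x ∉ Y) (hy : y ∉ insert z (insert x Y)) :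
    mc {z} x * mc (insert x Y) y * mc {z} x = mc (insert z Y) y * mc (insert x Y) y :=
  (mc_conj_aux _ n Y rfl).1 z x y hzx hz hx hy

/-! ### The product rule for arbitrary control sets. -/

lemma mc_mul_mc_of_two_le {n : ℕ} {X Y : Finset (Fin n)} {x y : Fin n} (hX : 2 ≤ X.card)
    (hxX : x ∉ X) (hxY : x ∉ Y) (hyx : y ≠ x) (hy : y ∉ X ∪ Y) :
    mc X x * mc (insert x Y) y = mc (X ∪ Y) y * (mc (insert x Y) y * mc X x) := by
  induction hk : X.card using Nat.strong_induction_on generalizing n with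
  | _ k ih =>
  obtain ⟨a, b, X, rfl, hab, ha, hb, hc⟩ := exists_insert_insert hX
  -- With exactly two controls, folding would leave one, below the bound `hX`; this is the base
  -- case.
  by_cases hX0 : X = ∅
  · subst hX0
    simp only [insert_empty_eq] at *
    have h := tof_mc_tof (Y := Y) (x := x) (y := y) hab (by simp at hxX ⊢; tauto)
      (by simp at hy ⊢; tauto)
    have e : {a, b} ∪ Y = insert a (insert b Y) := by ext; simp
    rw [e, ← mul_assoc, ← h, mul_assoc, mc_sq, mul_one]
  have hpos : 1 ≤ X.card := Finset.card_pos.2 (Finset.nonempty_iff_ne_empty.2 hX0)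
  apply cancel_Z
  simp only [map_mul, place_mc, Finset.map_insert, Finset.map_union]
  have hih := ih (X.card + 1) (by omega) (X := insert (Fin.last n) (X.map up)) (Y := Y.map up)
    (x := up x) (y := up y) (by rw [Finset.card_insert_of_notMem (last_notMem_up X), Finset.card_map]; omega)
    (by simp [up_ne_last] at hxX ⊢; tauto) (by rwa [up_mem]) (by rwa [Ne, up_inj])
    (by simp [up_ne_last] at hy ⊢; tauto) (by simp [up_ne_last])
  have h1 := Z_mul_mc (X := X.map up) (a := up a) (b := up b) (x := up x) (z := Fin.last n)
    (by rwa [Ne, up_inj]) (by rwa [up_mem]) (by rwa [up_mem])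
    (by simpa [up_inj, up_mem] using hxX) (by simp [last_ne_up, up_ne_last]) (last_ne_up x)
  have h2 := tof_mc_tof (Y := X.map up ∪ Y.map up) (a := up a) (b := up b) (x := Fin.last n)
    (y := up y) (by rwa [Ne, up_inj]) (by simp [last_ne_up, up_ne_last])
    (by simp [up_ne_last] at hy ⊢; tauto)
  have h3 : Z (Fin.last n) * mc (insert (Fin.last n) (X.map up ∪ Y.map up)) (up y) = _ :=
    Z_mul_mc_of_mem (Finset.mem_insert_self _ _) _
  have c1 : Commute (mc {up a, up b} (Fin.last n)) (mc (insert (up x) (Y.map up)) (up y)) :=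
    mc_commute (by simp [last_ne_up, up_ne_last]) (by simp at hy ⊢; tauto)
  have c2 : Commute (Z (Fin.last n))
      (mc (insert (up a) (insert (up b) (X.map up ∪ Y.map up))) (up y)) :=
    commute_Z_mc (by simp [last_ne_up, up_ne_last]) (last_ne_up y)
  have c3 : Commute (Z (Fin.last n)) (mc (insert (up x) (Y.map up)) (up y)) :=
    commute_Z_mc (by simp [last_ne_up, up_ne_last]) (last_ne_up y)
  have e : insert (up a) (insert (up b) (X.map up)) ∪ Y.map up =
      insert (up a) (insert (up b) (X.map up ∪ Y.map up)) := by
    ext; simp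
  have sT := mc_sq {up a, up b} (Fin.last n)
  rw [Finset.insert_union] at hih
  rw [e]
  generalize mc {up a, up b} (Fin.last n) = T at *
  generalize mc (insert (up x) (Y.map up)) (up y) = H at *
  generalize mc (insert (Fin.last n) (X.map up)) (up x) = G at *
  generalize mc (insert (up a) (insert (up b) (X.map up))) (up x) = A at *
  generalize mc (insert (up a) (insert (up b) (X.map up ∪ Y.map up))) (up y) = K at *
  generalize mc (insert (Fin.last n) (X.map up ∪ Y.map up)) (up y) = L at *
  -- The induction hypothesis produces `L`, controlled by the ancilla. Moving `T` past it yields the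
  -- desired `K`, and `Z` absorbs what is left of `L`.
  have h4 : T * L = K * L * T := by rw [← h2, mul_assoc, sT, mul_one]
  calc Z (Fin.last n) * (A * H) = Z (Fin.last n) * (T * G * (T * H)) := by
        rw [← mul_assoc, h1]; simp only [mul_assoc]
    _ = Z (Fin.last n) * (T * (G * H) * T) := by rw [c1.eq]; simp only [mul_assoc]
    _ = Z (Fin.last n) * ((T * L) * H * G * T) := by rw [hih]; simp only [mul_assoc]
    _ = Z (Fin.last n) * K * (L * (T * H) * G * T) := by rw [h4]; simp only [mul_assoc]
    _ = K * (Z (Fin.last n) * L) * (H * T * G * T) := by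
        rw [c2.eq, c1.eq]; simp only [mul_assoc]
    _ = K * (Z (Fin.last n) * H) * T * G * T := by rw [h3]; simp only [mul_assoc]
    _ = K * H * (Z (Fin.last n) * (T * G * T)) := by rw [c3.eq]; simp only [mul_assoc]
    _ = K * (H * Z (Fin.last n)) * A := by rw [← h1]; simp only [mul_assoc]
    _ = (K * Z (Fin.last n)) * H * A := by rw [← c3.eq]; simp only [mul_assoc]
    _ = Z (Fin.last n) * (K * (H * A)) := by rw [← c2.eq]; simp only [mul_assoc]

lemma mc_mul_mc {n : ℕ} {X Y : Finset (Fin n)} {x y : Fin n}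
    (hxX : x ∉ X) (hxY : x ∉ Y) (hyx : y ≠ x) (hy : y ∉ X ∪ Y) :
    mc X x * mc (insert x Y) y = mc (X ∪ Y) y * (mc (insert x Y) y * mc X x) := by
  -- Controls in state 1 are added to `X` until it has at least two elements.
  induction hk : 2 - X.card generalizing n with
  | zero => exact mc_mul_mc_of_two_le (by omega) hxX hxY hyx hy
  | succ k ih =>
    apply cancel_O
    simp only [map_mul, place_mc, Finset.map_insert, Finset.map_union]
    have h := ih (X := insert (Fin.last n) (X.map up)) (Y := Y.map up)
      (x := up x) (y := up y) (by simp [up_ne_last] at hxX ⊢; tauto) (by rwa [up_mem])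
      (by rwa [Ne, up_inj]) (by simp [up_ne_last] at hy ⊢; tauto)
      (by simp [up_ne_last]; omega)
    rw [Finset.insert_union] at h
    have p1 := O_mul_mc (last_notMem_up X) (last_ne_up x) (by rwa [up_mem])
    have p2 := O_mul_mc (last_notMem_up (X ∪ Y)) (last_ne_up y) (by rwa [up_mem])
    rw [Finset.map_union] at p2
    have c1 : Commute (O (Fin.last n)) (mc (X.map up ∪ Y.map up) (up y)) :=
      commute_O_mc (by simp [up_ne_last]) (last_ne_up y)
    have c2 : Commute (O (Fin.last n)) (mc (insert (up x) (Y.map up)) (up y)) :=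
      commute_O_mc (by simp [last_ne_up, up_ne_last]) (last_ne_up y)
    generalize mc (insert (up x) (Y.map up)) (up y) = H at *
    rw [← mul_assoc, ← p1, mul_assoc, h, ← mul_assoc, p2, c1.left_comm, c2.left_comm, ← p1,
      ← mul_assoc H, ← c2.eq, ← mul_assoc, ← mul_assoc, ← mul_assoc, c1.eq]

/-! ### Newly created wires in state 0. -/

lemma zeroKet_comp_Z {n : ℕ} (z : Fin (n + 1)) : zeroKet z ≫ Z z = zeroKet z := by
  have h : zeroKet z = ins (mk Circ.ket0) z := rfl
  rw [h, Z, ← rem_ins, ← Category.assoc, ins_rem ket0_bra0, Category.id_comp]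

lemma zeroKet_comp_congr {n : ℕ} {z : Fin (n + 1)} {f g : Op (n + 1)} (h : Z z * f = Z z * g) :
    zeroKet z ≫ f = zeroKet z ≫ g := by
  rw [← zeroKet_comp_Z, Category.assoc, Category.assoc]
  exact congrArg (zeroKet z ≫ ·) h

/-- By `cnot_mc_cnot`, moving the controlled not past the gate controlled by `z` yields the gate
controlled by `x` as a further factor; `Z z` then absorbs the gate controlled by `z`. -/
lemma Z_mul_cnot_mul_mc {n : ℕ} {X : Finset (Fin n)} {x y z : Fin n} (hzx : z ≠ x) (hx : x ∉ X)
    (hz : z ∉ X) (hy : y ∉ insert x (insert z X)) :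
    Z z * (mc {x} z * mc (insert x X) y) = Z z * (mc {x} z * mc (insert z X) y) := by
  have h := cnot_mc_cnot (Y := X) (z := x) (x := z) (y := y) hzx.symm hx hz hy
  have h' : mc {x} z * mc (insert z X) y = mc (insert x X) y * mc (insert z X) y * mc {x} z := by
    rw [← h, mul_assoc _ (mc {x} z), mc_sq, mul_one]
  have c1 : Commute (mc (insert x X) y) (mc (insert z X) y) :=
    mc_commute (by simp at hy ⊢; tauto) (by simp at hy ⊢; tauto)
  have c2 : Commute (mc {x} z) (mc (insert x X) y) :=
    mc_commute (by simp [hzx, hz]) (by simp at hy ⊢; tauto)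
  rw [h', c1.eq, mul_assoc, ← mul_assoc (Z z) (mc (insert z X) y), Z_mul_mc_of_mem (Finset.mem_insert_self _ _), c2.eq]

end TOF

theorem mainTheorem7 :
    (∀ (n : ℕ) (X : Finset (Fin n)) (x : Fin n) (hx : x ∉ X),
      TOF.mcx X x hx ≫ TOF.mcx X x hx = 𝟙 (TOF.of n)) ∧
    (∀ (n : ℕ) (X : Finset (Fin (n + 1))) (x y : Fin (n + 1)) (_ : x ∈ X) (hy : y ∉ X),
      TOF.zeroKet x ≫ TOF.mcx X y hy = TOF.zeroKet x) ∧
    (∀ (n : ℕ) (X Y : Finset (Fin n)) (x : Fin n) (hX : x ∉ X) (hY : x ∉ Y),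
      TOF.mcx X x hX ≫ TOF.mcx Y x hY = TOF.mcx Y x hY ≫ TOF.mcx X x hX) ∧
    (∀ (n : ℕ) (X Y : Finset (Fin n)) (x y : Fin n) (hx : x ∉ X) (hy : y ∉ Y)
      (_ : x ∉ Y) (_ : y ∉ X),
      TOF.mcx X x hx ≫ TOF.mcx Y y hy = TOF.mcx Y y hy ≫ TOF.mcx X x hx) ∧
    (∀ (n : ℕ) (X Y : Finset (Fin n)) (x y : Fin n) (hx : x ∉ X) (_ : x ∉ Y)
      (hy : y ∉ insert x Y) (hy' : y ∉ X ∪ Y),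
      TOF.mcx X x hx ≫ TOF.mcx (insert x Y) y hy =
        TOF.mcx (X ∪ Y) y hy' ≫ TOF.mcx (insert x Y) y hy ≫ TOF.mcx X x hx) ∧
    (∀ (n : ℕ) (X : Finset (Fin (n + 1))) (x y z : Fin (n + 1)) (hz : z ∉ ({x} : Finset _))
      (_ : x ∉ X) (_ : z ∉ X) (hy : y ∉ insert x X) (hy' : y ∉ insert z X),
      TOF.zeroKet z ≫ TOF.mcx {x} z hz ≫ TOF.mcx (insert x X) y hy =
        TOF.zeroKet z ≫ TOF.mcx {x} z hz ≫ TOF.mcx (insert z X) y hy') := by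
  simp only [TOF.mcx_eq_mc]
  refine ⟨fun n X x _ => TOF.mc_sq X x, fun n X x y hx _ => ?_,
    fun n X Y x hX hY => (TOF.mc_commute hY hX).eq,
    fun n X Y x y _ _ hx hy => (TOF.mc_commute hx hy).eq, fun n X Y x y hX hY hy hy' => ?_,
    fun n X x y z hz hx hzX hy hy' => ?_⟩
  · refine (TOF.zeroKet_comp_congr (g := 1) ?_).trans (Category.comp_id _)
    rw [TOF.Z_mul_mc_of_mem hx, mul_one]
  · exact TOF.mc_mul_mc hX hY (by simp at hy; tauto) hy'
  · refine TOF.zeroKet_comp_congr (TOF.Z_mul_cnot_mul_mc (by simpa using hz) hx hzX ?_)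
    simp at hy hy' ⊢
    tauto
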